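/- Let $k\ge 3$ be an integer. For $i\in\{1,\dots,k\}$ let $C_i\subset\mathbb R^2$ be the cone of nonzero vectors whose counterclockwise angle from the positive $x$-axis lies in $[2\pi(i-1)/k,\,2\pi i/k)$. For a set $S\subset\mathbb R^2$, the graph $\theta_k(S)$ is the undirected graph on $S$ in which every $u\in S$ is joined, for each $i$, to the point $w\in S\cap(u+C_i)$ (if any) whose orthogonal projection onto the axis (bisector) of $u+C_i$ is closest to $u$; we then say that $u$ chooses the edge $uw$ in its $i$-th cone. An edge $uw$ is mutual if it is chosen both by $u$ and by $w$. Let $\Pi$ be a homogeneous Poisson point process of unit intensity on $\mathbb R^2$, with the origin $o$ added as a typical point. Let $p_k$ be the probability that, in $\theta_k(\Pi\cup\{o\})$, the edge chosen by $o$ in a uniformly random one of its $k$ cones is mutual, and put $d_k=(2-p_k)k$ (the average degree of the $\theta_k$-graph in the Poisson model). Then there is an absolute constant $C$ such that, for all integers $k\ge 3$ and $n\ge 2$, if $S$ is a set of $n$ points that are independently and uniformly distributed in $[0,1]^2$ and $m_k$ is the number of edges of $\theta_k(S)$, then $$\Bigl|\,\mathbb E[m_k]-\frac{n\,d_k}{2}\Bigr|\;\le\;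 C\,k\sqrt{nk\log n}.$$ -/

import Mathlib

open MeasureTheory ProbabilityTheory

/-- The `i`-th of the `k` half-open cones with apex the origin: the nonzero vectors of the plane
(identified with `ℂ`) whose counterclockwise angle from the positive horizontal axis lies in
`[2πi/k, 2π(i+1)/k)`. Indices run from `0` to `k - 1`. -/
def thetaCone (k : ℕ) (i : Fin k) : Set ℂ :=
  {z | ∃ r : ℝ, 0 < r ∧
    ∃ φ ∈ Set.Ico (2 * Real.pi * (i : ℕ) / k) (2 * Real.pi * ((i : ℕ) + 1) / k),
      z = (r : ℂ) * Complex.exp ((φ : ℂ) * Complex.I)}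

/-- The unit vector that spans the axis (the bisector) of the `i`-th cone. -/
noncomputable def thetaAxis (k : ℕ) (i : Fin k) : ℂ :=
  Complex.exp (((Real.pi * (2 * (i : ℕ) + 1) / k : ℝ) : ℂ) * Complex.I)

/-- The signed distance from the origin of the orthogonal projection of `z` onto the axis of the
`i`-th cone. -/
noncomputable def thetaHeight (k : ℕ) (i : Fin k) (z : ℂ) : ℝ :=
  inner ℝ (thetaAxis k i) z

/-- In the point set `S`, the point `u` chooses `w` in its `i`-th cone: `w` is a point of `S` in
the cone with apex `u`, and no point of `S` in that cone has a projection onto the axis closer to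
`u`. (If several points tie, all of them are chosen; for random points this has
probability zero.) -/
def ThetaChooses (k : ℕ) (S : Set ℂ) (i : Fin k) (u w : ℂ) : Prop :=
  u ∈ S ∧ w ∈ S ∧ w - u ∈ thetaCone k i ∧
    ∀ v ∈ S, v - u ∈ thetaCone k i → thetaHeight k i (w - u) ≤ thetaHeight k i (v - u)

/-- The (undirected) `θ_k`-graph of a planar point set `S`, as a graph on the plane in which the
points outside `S` are isolated. -/
def thetaGraph (k : ℕ) (S : Set ℂ) : SimpleGraph ℂ where
  Adj u w := u ≠ w ∧ ((∃ i, ThetaChooses k S i u w) ∨ ∃ i, ThetaChooses k S i w u)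
  symm := ⟨fun _ _ h => ⟨h.1.symm, h.2.symm⟩⟩
  loopless := ⟨fun _ h => h.1 rfl⟩

/-- The number of edges of the `θ_k`-graph of `S` (meaningful for finite `S`). -/
noncomputable def thetaEdgeCount (k : ℕ) (S : Set ℂ) : ℕ :=
  (thetaGraph k S).edgeSet.ncard

/-- The square `[0,1]²`. -/
def unitSquare : Set ℂ := {z | z.re ∈ Set.Icc (0 : ℝ) 1 ∧ z.im ∈ Set.Icc (0 : ℝ) 1}

theorem volume_unitSquare : (volume : Measure ℂ) unitSquare = 1 := by
  have h : unitSquare = Complex.measurableEquivRealProd ⁻¹'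
      (Set.Icc (0 : ℝ) 1 ×ˢ Set.Icc (0 : ℝ) 1) := by
    ext z
    simp [unitSquare, Complex.measurableEquivRealProd_apply]
    tauto
  rw [h, Complex.volume_preserving_equiv_real_prod.measure_preimage_equiv,
    Measure.volume_eq_prod, Measure.prod_prod]
  simp

/-- The uniform distribution on the unit square. -/
noncomputable def uniformSquare : Measure ℂ := cond volume unitSquare

instance : IsProbabilityMeasure uniformSquare :=
  cond_isProbabilityMeasure_of_finite (by simp [volume_unitSquare]) (by simp [volume_unitSquare])

/-- Sample space for a homogeneous Poisson point process on the plane: to each cell of the unit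
square lattice a number of points and a sequence of candidate positions in `[0,1]²`. -/
abbrev PoissonSpace : Type := ℤ × ℤ → ℕ × (ℕ → ℂ)

/-- In each lattice cell, independently of the other cells, the number of points has the Poisson
distribution with mean `1` and the positions are independent and uniform. -/
noncomputable def poissonLaw : Measure PoissonSpace :=
  Measure.infinitePi fun _ : ℤ × ℤ =>
    (poissonMeasure 1).prod (Measure.infinitePi fun _ : ℕ => uniformSquare)

/-- The points of the configuration `ω`. Under `poissonLaw` this is a homogeneous Poisson point
process of unit intensity on the whole plane. -/
def poissonPoints (ω : PoissonSpace) : Set ℂ :=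
  {z | ∃ (c : ℤ × ℤ) (j : ℕ), j < (ω c).1 ∧
    z = ((c.1 : ℝ) : ℂ) + ((c.2 : ℝ) : ℂ) * Complex.I + (ω c).2 j}

/-- The edge chosen by `u` in its `i`-th cone exists and is mutual: it is also chosen by its other
endpoint. -/
def ThetaMutual (k : ℕ) (S : Set ℂ) (i : Fin k) (u : ℂ) : Prop :=
  ∃ w, ThetaChooses k S i u w ∧ ∃ j, ThetaChooses k S j w u

/-- The mutual edge probability `p_k`: the probability that, in the `θ_k`-graph of a homogeneous
Poisson point process with a typical point at the origin (that is, of the process with the origin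
added), the edge chosen by the origin in a uniformly random one of its `k` cones is mutual. -/
noncomputable def mutualProb (k : ℕ) : ℝ :=
  (∑ i : Fin k, poissonLaw.real {ω | ThetaMutual k (insert 0 (poissonPoints ω)) i 0}) / k

/-- The average degree `d_k = (2 - p_k) k` of the `θ_k`-graph in the Poisson model. -/
noncomputable def avgDegree (k : ℕ) : ℝ := (2 - mutualProb k) * k

/-! Choosing is a void event: `u` chooses `w` exactly when `thetaBlock k u w` contains no point of
the set, and the choice is mutual exactly when `mutualBlock k u w` contains none. Counting choices
counts mutual edges twice, so the number of edges is the sum over ordered pairs of [first region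
empty] - 1/2 [second region empty] (`thetaEdgeCount_range`). Both terms have the same shape and are
estimated together for any family `B` of regions satisfying `IsBlocking`.

For `n` uniform points in the square Q, conditioning on the positions of two of them gives, for each
kind of term, `n` times the mean over `u` of `freeCount n B u` = (n-1) ∫_Q (1 - |B u w ∩ Q|)^(n-2)
dw. In the Poisson model, Mecke's formula gives k p_k = ∫ exp(-|B 0 w|) dw = `freeIntegral B` for
the mutual region (`avgDegree_eq`); for `thetaBlock` the same integral equals `k`. Areas scale
quadratically, so `freeIntegral B` is also n ∫ exp(-n |B 0 w|) dw. It remains to show that the mean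
of `freeCount n B` differs from `freeIntegral B` by O(k r), with r = √(2k log n / n) the `cutoff`;
multiplying by `n` gives the claimed order.

If `u` has distance at least 3r from the boundary, pairs at distance at most r have their region
inside the square, and only (1-g)^(n-2) has to be compared with exp(-n g). For pairs further apart,
the region contains area of order log n / n near `u`, so both integrands are small
(`pointwise_error`). The remaining `u` form a strip of area O(r), where it is enough that both
quantities are O(k) (`freeCount_le`, `freeIntegral_le`). The bound on `freeCount` holds up to the
boundary by a rank argument: inside one cone, the area of `thetaBlock` within the square is the rank
of the height of `w`, and ranks are dominated by Lebesgue measure (`measure_rank_lt_le`). -/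

/-! ### Geometry of the cones -/

/-- The counterclockwise angle of `z` from the positive horizontal axis, in `[0, 2π)`. -/
noncomputable def polarAngle (z : ℂ) : ℝ :=
  if z.arg < 0 then z.arg + 2 * Real.pi else z.arg

theorem polarAngle_nonneg (z : ℂ) : 0 ≤ polarAngle z := by
  unfold polarAngle
  have := Complex.neg_pi_lt_arg z
  have := Real.pi_pos
  split_ifs <;> linarith

theorem polarAngle_lt (z : ℂ) : polarAngle z < 2 * Real.pi := by
  unfold polarAngle
  have := Complex.arg_le_pi z
  have := Real.pi_pos
  split_ifs <;> linarith

theorem measurable_polarAngle : Measurable polarAngle := by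
  unfold polarAngle
  exact Measurable.ite (measurableSet_lt Complex.measurable_arg measurable_const)
    (Complex.measurable_arg.add_const _) Complex.measurable_arg

theorem norm_mul_exp_polarAngle (z : ℂ) :
    z = (‖z‖ : ℂ) * Complex.exp ((polarAngle z : ℂ) * Complex.I) := by
  unfold polarAngle
  split_ifs with h
  · push_cast
    rw [add_mul, Complex.exp_add, Complex.exp_two_pi_mul_I, mul_one, Complex.norm_mul_exp_arg_mul_I]
  · rw [Complex.norm_mul_exp_arg_mul_I]

theorem polarAngle_mul_exp {r φ : ℝ} (hr : 0 < r) (h0 : 0 ≤ φ) (h1 : φ < 2 * Real.pi) :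
    polarAngle ((r : ℂ) * Complex.exp ((φ : ℂ) * Complex.I)) = φ := by
  rcases le_or_gt φ Real.pi with h | h
  · have : Complex.arg ((r : ℂ) * Complex.exp ((φ : ℂ) * Complex.I)) = φ := by
      rw [Complex.exp_mul_I]
      exact Complex.arg_mul_cos_add_sin_mul_I hr ⟨by linarith [Real.pi_pos], h⟩
    simp [polarAngle, this, not_lt.2 h0]
  · have : Complex.arg ((r : ℂ) * Complex.exp ((φ : ℂ) * Complex.I)) = φ - 2 * Real.pi := by
      have e : Complex.exp ((φ : ℂ) * Complex.I)
          = Complex.exp (((φ - 2 * Real.pi : ℝ) : ℂ) * Complex.I) := by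
        push_cast
        rw [sub_mul, Complex.exp_sub, Complex.exp_two_pi_mul_I, div_one]
      rw [e, Complex.exp_mul_I]
      exact Complex.arg_mul_cos_add_sin_mul_I hr ⟨by linarith [Real.pi_pos], by linarith⟩
    rw [polarAngle, this, if_pos (by linarith)]
    ring

theorem mem_thetaCone_iff {k : ℕ} (i : Fin k) (z : ℂ) :
    z ∈ thetaCone k i ↔ z ≠ 0 ∧ polarAngle z ∈
      Set.Ico (2 * Real.pi * (i : ℕ) / k) (2 * Real.pi * ((i : ℕ) + 1) / k) := by
  have hk : 0 < (k : ℝ) := Nat.cast_pos.2 i.pos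
  constructor
  · rintro ⟨r, hr, φ, hφ, rfl⟩
    have h0 : 0 ≤ φ := le_trans (by positivity) hφ.1
    have h1 : φ < 2 * Real.pi := by
      refine hφ.2.trans_le ?_
      rw [div_le_iff₀ hk]
      have : ((i : ℕ) : ℝ) + 1 ≤ k := by exact_mod_cast i.2
      have := Real.pi_pos
      gcongr
    rw [polarAngle_mul_exp hr h0 h1]
    exact ⟨mul_ne_zero (by exact_mod_cast hr.ne') (Complex.exp_ne_zero _), hφ⟩
  · rintro ⟨h0, h⟩
    exact ⟨‖z‖, norm_pos_iff.2 h0, polarAngle z, h, norm_mul_exp_polarAngle z⟩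

theorem zero_notMem_thetaCone {k : ℕ} (i : Fin k) : (0 : ℂ) ∉ thetaCone k i :=
  fun h => ((mem_thetaCone_iff i 0).1 h).1 rfl

theorem measurableSet_thetaCone {k : ℕ} (i : Fin k) : MeasurableSet (thetaCone k i) := by
  have : thetaCone k i = {0}ᶜ ∩ polarAngle ⁻¹'
      Set.Ico (2 * Real.pi * (i : ℕ) / k) (2 * Real.pi * ((i : ℕ) + 1) / k) := by
    ext z
    simpa using mem_thetaCone_iff i z
  rw [this]
  exact (measurableSet_singleton _).compl.inter (measurable_polarAngle measurableSet_Ico)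

/-- Reading the cone index off as a floor yields both that the cones cover the punctured plane and
that they are disjoint. -/
theorem mem_thetaCone_iff_floor {k : ℕ} (i : Fin k) {z : ℂ} (hz : z ≠ 0) :
    z ∈ thetaCone k i ↔ ⌊k * polarAngle z / (2 * Real.pi)⌋₊ = i := by
  have hk : 0 < (k : ℝ) := Nat.cast_pos.2 i.pos
  have hpi := Real.pi_pos
  have h0 := polarAngle_nonneg z
  rw [mem_thetaCone_iff, Nat.floor_eq_iff (by positivity), Set.mem_Ico, div_le_iff₀ hk,
    lt_div_iff₀ hk, le_div_iff₀ (by positivity), div_lt_iff₀ (by positivity)]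
  constructor
  · rintro ⟨-, h1, h2⟩
    constructor <;> linarith
  · rintro ⟨h1, h2⟩
    exact ⟨hz, by linarith, by linarith⟩

theorem exists_mem_thetaCone {k : ℕ} (hk : 0 < k) {z : ℂ} (hz : z ≠ 0) :
    ∃ i : Fin k, z ∈ thetaCone k i := by
  have hpi := Real.pi_pos
  have h0 := polarAngle_nonneg z
  have h1 := polarAngle_lt z
  have hk' : 0 < (k : ℝ) := Nat.cast_pos.2 hk
  refine ⟨⟨⌊k * polarAngle z / (2 * Real.pi)⌋₊, ?_⟩, (mem_thetaCone_iff_floor _ hz).2 rfl⟩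
  rw [Nat.floor_lt (by positivity), div_lt_iff₀ (by positivity)]
  gcongr

theorem thetaCone_index_unique {k : ℕ} {i j : Fin k} {z : ℂ} (hi : z ∈ thetaCone k i)
    (hj : z ∈ thetaCone k j) : i = j := by
  have hz := ((mem_thetaCone_iff i z).1 hi).1
  exact Fin.ext (((mem_thetaCone_iff_floor i hz).1 hi).symm.trans
    ((mem_thetaCone_iff_floor j hz).1 hj))

theorem thetaCone_mul_pos {k : ℕ} (i : Fin k) {c : ℝ} (hc : 0 < c) (z : ℂ) :
    (c : ℂ) * z ∈ thetaCone k i ↔ z ∈ thetaCone k i := by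
  have key : ∀ {c : ℝ}, 0 < c → ∀ z, z ∈ thetaCone k i → (c : ℂ) * z ∈ thetaCone k i := by
    rintro c hc z ⟨r, hr, φ, hφ, rfl⟩
    exact ⟨c * r, by positivity, φ, hφ, by push_cast; ring⟩
  refine ⟨fun h => ?_, key hc z⟩
  have := key (inv_pos.2 hc) _ h
  rwa [Complex.ofReal_inv, inv_mul_cancel_left₀ (by exact_mod_cast hc.ne')] at this

theorem thetaHeight_mul_ofReal {k : ℕ} (i : Fin k) (c : ℝ) (z : ℂ) :
    thetaHeight k i ((c : ℂ) * z) = c * thetaHeight k i z := by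
  rw [thetaHeight, thetaHeight, ← Complex.real_smul, inner_smul_right]

theorem continuous_thetaHeight (k : ℕ) (i : Fin k) : Continuous (thetaHeight k i) := by
  unfold thetaHeight
  fun_prop

theorem norm_thetaAxis (k : ℕ) (i : Fin k) : ‖thetaAxis k i‖ = 1 :=
  Complex.norm_exp_ofReal_mul_I _

theorem thetaHeight_le_norm {k : ℕ} (i : Fin k) (z : ℂ) : thetaHeight k i z ≤ ‖z‖ := by
  have := real_inner_le_norm (thetaAxis k i) z
  rwa [norm_thetaAxis, one_mul] at this

/-- A vector of the cone makes an angle of at most π/k ≤ π/3 with the axis, and cos(π/3) = 1/2. This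
is where `k ≥ 3` enters the geometry: height and norm are comparable, so blocking regions are
bounded. -/
theorem half_norm_le_thetaHeight {k : ℕ} (hk : 3 ≤ k) {i : Fin k} {z : ℂ}
    (hz : z ∈ thetaCone k i) : ‖z‖ / 2 ≤ thetaHeight k i z := by
  obtain ⟨r, hr, φ, hφ, rfl⟩ := hz
  have hk' : (3 : ℝ) ≤ k := by exact_mod_cast hk
  have hk0 : (0 : ℝ) < k := by linarith
  have hpi := Real.pi_pos
  have e : thetaHeight k i ((r : ℂ) * Complex.exp ((φ : ℂ) * Complex.I))
      = r * Real.cos (φ - Real.pi * (2 * (i : ℕ) + 1) / k) := by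
    rw [thetaHeight_mul_ofReal, thetaHeight, thetaAxis, Complex.inner, ← Complex.exp_conj,
      ← Complex.exp_add, ← Complex.exp_ofReal_mul_I_re]
    congr 3
    simp only [map_mul, Complex.conj_ofReal, Complex.conj_I]
    push_cast
    ring
  rw [e, norm_mul, Complex.norm_exp_ofReal_mul_I, Complex.norm_real, Real.norm_of_nonneg hr.le,
    mul_one, div_eq_mul_inv]
  refine mul_le_mul_of_nonneg_left ?_ hr.le
  rw [← one_div, ← Real.cos_pi_div_three, ← Real.cos_abs (φ - _)]
  have h3 : Real.pi / k ≤ Real.pi / 3 := by gcongr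
  refine Real.cos_le_cos_of_nonneg_of_le_pi (abs_nonneg _) (by linarith) ?_
  have e1 : 2 * Real.pi * (i : ℕ) / k = Real.pi * (2 * (i : ℕ) + 1) / k - Real.pi / k := by ring
  have e2 : 2 * Real.pi * ((i : ℕ) + 1) / k = Real.pi * (2 * (i : ℕ) + 1) / k + Real.pi / k := by
    ring
  have h1 := hφ.1
  have h2 := hφ.2
  rw [e1] at h1
  rw [e2] at h2
  rw [abs_le]
  constructor <;> linarith

theorem thetaCone_eq_preimage_rotation {k : ℕ} (i j : Fin k) (z : ℂ) :
    z ∈ thetaCone k i ↔ Complex.exp (((2 * Real.pi * ((j : ℕ) - (i : ℕ)) / k : ℝ) : ℂ) * Complex.I)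
      * z ∈ thetaCone k j := by
  have key : ∀ (i j : Fin k) (z : ℂ), z ∈ thetaCone k i →
      Complex.exp (((2 * Real.pi * ((j : ℕ) - (i : ℕ)) / k : ℝ) : ℂ) * Complex.I)
      * z ∈ thetaCone k j := by
    rintro i j z ⟨r, hr, φ, hφ, rfl⟩
    refine ⟨r, hr, φ + 2 * Real.pi * ((j : ℕ) - (i : ℕ)) / k, ?_, ?_⟩
    · have e1 : 2 * Real.pi * ((j : ℕ) - (i : ℕ)) / k
        = 2 * Real.pi * (j : ℕ) / k - 2 * Real.pi * (i : ℕ) / k := by ring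
      have e2 : 2 * Real.pi * ((j : ℕ) - (i : ℕ)) / k
        = 2 * Real.pi * ((j : ℕ) + 1) / k - 2 * Real.pi * ((i : ℕ) + 1) / k := by ring
      exact ⟨by linarith [hφ.1], by linarith [hφ.2]⟩
    · rw [mul_left_comm, ← Complex.exp_add]
      congr 2
      push_cast
      ring
  refine ⟨key i j z, fun h => ?_⟩
  have := key j i _ h
  rw [← mul_assoc, ← Complex.exp_add] at this
  convert this
  rw [← add_mul, ← Complex.ofReal_add, show 2 * Real.pi * (((i : ℕ) : ℝ) - (j : ℕ)) / k
    + 2 * Real.pi * ((j : ℕ) - (i : ℕ)) / k = 0 by ring]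
  simp

/-- The `k` sectors are rotations of one another and partition the ball minus its centre, so each
has one `k`-th of its area. -/
theorem volume_thetaCone_inter_ball {k : ℕ} (i : Fin k) {ρ : ℝ} (hρ : 0 < ρ) :
    volume (thetaCone k i ∩ Metric.ball 0 ρ) = ENNReal.ofReal (Real.pi * ρ ^ 2 / k) := by
  have hk : 0 < k := i.pos
  have hrot : ∀ j, volume (thetaCone k i ∩ Metric.ball 0 ρ)
      = volume (thetaCone k j ∩ Metric.ball 0 ρ) := by
    intro j
    let a : Circle := Circle.exp (2 * Real.pi * ((j : ℕ) - (i : ℕ)) / k)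
    have hmp := (rotation a).measurePreserving
    rw [← hmp.measure_preimage
      ((measurableSet_thetaCone j).inter measurableSet_ball).nullMeasurableSet]
    congr 1
    ext z
    simp only [Set.mem_inter_iff, Set.mem_preimage, mem_ball_zero_iff,
      rotation_apply, a, Circle.coe_exp]
    rw [thetaCone_eq_preimage_rotation i j, norm_mul, Complex.norm_exp_ofReal_mul_I, one_mul]
  have hsum : volume (Metric.ball (0 : ℂ) ρ)
      = ∑ j : Fin k, volume (thetaCone k j ∩ Metric.ball 0 ρ) := by
    rw [← measure_biUnion_finset]
    · refine measure_congr ?_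
      have : ∀ᵐ z : ℂ, z ≠ 0 := by
        simp [ae_iff]
      filter_upwards [this] with z hz
      obtain ⟨j, hj⟩ := exists_mem_thetaCone hk hz
      apply propext
      change z ∈ Metric.ball 0 ρ ↔ z ∈ ⋃ j ∈ (Finset.univ : Finset (Fin k)), _
      simp only [Finset.mem_univ, Set.iUnion_true, Set.mem_iUnion, Set.mem_inter_iff]
      exact ⟨fun h => ⟨j, hj, h⟩, fun ⟨_, _, h⟩ => h⟩
    · intro a _ b _ hab
      exact Set.disjoint_left.2 fun z hz hz' => hab (thetaCone_index_unique hz.1 hz'.1)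
    · exact fun j _ => (measurableSet_thetaCone j).inter measurableSet_ball
  rw [Finset.sum_congr rfl fun j _ => (hrot j).symm, Finset.sum_const, Finset.card_univ,
    Fintype.card_fin, nsmul_eq_mul, Complex.volume_ball] at hsum
  have hk' : (0 : ℝ) < k := Nat.cast_pos.2 hk
  rw [ENNReal.ofReal_div_of_pos hk', ENNReal.eq_div_iff (by simp [hk.ne']) (by simp),
    ENNReal.ofReal_natCast, ← hsum, ENNReal.ofReal_mul Real.pi_pos.le,
    ENNReal.ofReal_pow hρ.le, mul_comm]
  congr 1
  rw [← NNReal.coe_real_pi, ENNReal.ofReal_coe_nnreal]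

/-! ### Blocking regions -/

/-- The region that has to be free of points for `u` to choose `w`: the points in the cone of `u`
that contains `w` with a projection closer to `u` than that of `w`. -/
def thetaBlock (k : ℕ) (u w : ℂ) : Set ℂ :=
  {v | ∃ i, w - u ∈ thetaCone k i ∧ v - u ∈ thetaCone k i ∧
    thetaHeight k i (v - u) < thetaHeight k i (w - u)}

/-- The region that has to be free of points for `u` and `w` to choose each other. -/
def mutualBlock (k : ℕ) (u w : ℂ) : Set ℂ := thetaBlock k u w ∪ thetaBlock k w u

/-- A translation invariant and homogeneous assignment of a region to each pair of points that
contains the region `thetaBlock` and is not much larger. -/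
structure IsBlocking (k : ℕ) (B : ℂ → ℂ → Set ℂ) : Prop where
  measurableSet : MeasurableSet {p : ℂ × ℂ × ℂ | p.2.2 ∈ B p.1 p.2.1}
  translate : ∀ u w v a, v + a ∈ B (u + a) (w + a) ↔ v ∈ B u w
  scale : ∀ c : ℝ, 0 < c → ∀ u w v, (c : ℂ) * v ∈ B (c * u) (c * w) ↔ v ∈ B u w
  block_subset : ∀ u w, thetaBlock k u w ⊆ B u w
  subset_ball : ∀ u w, B u w ⊆ Metric.ball u (3 * ‖w - u‖)
  left_notMem : ∀ u w, u ∉ B u w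
  right_notMem : ∀ u w, w ∉ B u w

theorem thetaBlock_subset_ball {k : ℕ} (hk : 3 ≤ k) (u w : ℂ) :
    thetaBlock k u w ⊆ Metric.ball u (2 * ‖w - u‖) := by
  rintro v ⟨i, hw, hv, hlt⟩
  rw [Metric.mem_ball, dist_eq_norm]
  have h1 := half_norm_le_thetaHeight hk hv
  have h2 := thetaHeight_le_norm i (w - u)
  linarith

theorem left_notMem_thetaBlock (k : ℕ) (u w : ℂ) : u ∉ thetaBlock k u w := by
  rintro ⟨i, -, hu, -⟩
  rw [sub_self] at hu
  exact zero_notMem_thetaCone i hu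

theorem right_notMem_thetaBlock (k : ℕ) (u w : ℂ) : w ∉ thetaBlock k u w :=
  fun ⟨_, _, _, h⟩ => lt_irrefl _ h

theorem measurableSet_thetaBlock (k : ℕ) :
    MeasurableSet {p : ℂ × ℂ × ℂ | p.2.2 ∈ thetaBlock k p.1 p.2.1} := by
  have : {p : ℂ × ℂ × ℂ | p.2.2 ∈ thetaBlock k p.1 p.2.1} = ⋃ i : Fin k,
      ((fun p : ℂ × ℂ × ℂ => p.2.1 - p.1) ⁻¹' thetaCone k i ∩
        ((fun p : ℂ × ℂ × ℂ => p.2.2 - p.1) ⁻¹' thetaCone k i ∩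
        {p : ℂ × ℂ × ℂ | thetaHeight k i (p.2.2 - p.1) < thetaHeight k i (p.2.1 - p.1)})) := by
    ext p
    simp [thetaBlock]
  rw [this]
  refine MeasurableSet.iUnion fun i => ?_
  have hh := (continuous_thetaHeight k i).measurable
  refine (measurableSet_preimage (by fun_prop) (measurableSet_thetaCone i)).inter
    ((measurableSet_preimage (by fun_prop) (measurableSet_thetaCone i)).inter
    (measurableSet_lt (hh.comp (by fun_prop)) (hh.comp (by fun_prop))))

theorem thetaBlock_translate (k : ℕ) (u w v a : ℂ) :
    v + a ∈ thetaBlock k (u + a) (w + a) ↔ v ∈ thetaBlock k u w := by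
  simp [thetaBlock]

theorem thetaBlock_scale (k : ℕ) (c : ℝ) (hc : 0 < c) (u w v : ℂ) :
    (c : ℂ) * v ∈ thetaBlock k (c * u) (c * w) ↔ v ∈ thetaBlock k u w := by
  simp only [thetaBlock, Set.mem_ofPred_eq, ← mul_sub, thetaCone_mul_pos _ hc,
    thetaHeight_mul_ofReal, mul_lt_mul_iff_right₀ hc]

theorem isBlocking_thetaBlock {k : ℕ} (hk : 3 ≤ k) : IsBlocking k (thetaBlock k) where
  measurableSet := measurableSet_thetaBlock k
  translate := thetaBlock_translate k
  scale := thetaBlock_scale k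
  block_subset _ _ := subset_rfl
  subset_ball u w := (thetaBlock_subset_ball hk u w).trans
    (Metric.ball_subset_ball (by nlinarith [norm_nonneg (w - u)]))
  left_notMem := left_notMem_thetaBlock k
  right_notMem := right_notMem_thetaBlock k

theorem isBlocking_mutualBlock {k : ℕ} (hk : 3 ≤ k) : IsBlocking k (mutualBlock k) where
  measurableSet := by
    refine (measurableSet_thetaBlock k).union (?_ :
      MeasurableSet {p : ℂ × ℂ × ℂ | p.2.2 ∈ thetaBlock k p.2.1 p.1})
    exact measurableSet_preimage (f := fun p : ℂ × ℂ × ℂ => (p.2.1, p.1, p.2.2)) (by fun_prop)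
      (measurableSet_thetaBlock k)
  translate u w v a := or_congr (thetaBlock_translate k u w v a) (thetaBlock_translate k w u v a)
  scale c hc u w v := or_congr (thetaBlock_scale k c hc u w v) (thetaBlock_scale k c hc w u v)
  block_subset _ _ := Set.subset_union_left
  subset_ball u w := by
    refine Set.union_subset ((isBlocking_thetaBlock hk).subset_ball u w) ?_
    -- The radius 3 in `IsBlocking` comes from here: radius 2 around `w`, plus the distance from `u`
    -- to `w`.
    refine (thetaBlock_subset_ball hk w u).trans (Metric.ball_subset_ball' ?_)
    rw [dist_eq_norm, norm_sub_rev u w]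
    linarith
  left_notMem u w := not_or.2 ⟨left_notMem_thetaBlock k u w, right_notMem_thetaBlock k w u⟩
  right_notMem u w := not_or.2 ⟨right_notMem_thetaBlock k u w, left_notMem_thetaBlock k w u⟩

/-- Since `w - u` lies in only one cone, the cone index drops out and choosing becomes the emptiness
of a region depending on `u` and `w` alone. -/
theorem thetaChooses_iff {k : ℕ} {S : Set ℂ} {i : Fin k} {u w : ℂ} (hi : w - u ∈ thetaCone k i) :
    ThetaChooses k S i u w ↔ u ∈ S ∧ w ∈ S ∧ ∀ v ∈ S, v ∉ thetaBlock k u w := by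
  refine and_congr_right fun _ => and_congr_right fun _ => ?_
  rw [and_iff_right hi]
  refine forall₂_congr fun v _ => ⟨fun h hv => ?_, fun h hv => ?_⟩
  · obtain ⟨j, hj, hv, hlt⟩ := hv
    obtain rfl := thetaCone_index_unique hi hj
    exact absurd (h hv) (not_le.2 hlt)
  · by_contra hlt
    exact h ⟨i, hi, hv, not_le.1 hlt⟩

theorem exists_thetaChooses_iff {k : ℕ} (hk : 0 < k) {S : Set ℂ} {u w : ℂ} :
    (∃ i, ThetaChooses k S i u w) ↔
      u ≠ w ∧ u ∈ S ∧ w ∈ S ∧ ∀ v ∈ S, v ∉ thetaBlock k u w := by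
  constructor
  · rintro ⟨i, hi⟩
    refine ⟨?_, (thetaChooses_iff hi.2.2.1).1 hi⟩
    rintro rfl
    have := hi.2.2.1
    rw [sub_self] at this
    exact zero_notMem_thetaCone i this
  · rintro ⟨hne, h⟩
    obtain ⟨i, hi⟩ := exists_mem_thetaCone hk (sub_ne_zero.2 hne.symm)
    exact ⟨i, (thetaChooses_iff hi).2 h⟩

theorem thetaMutual_iff {k : ℕ} {S : Set ℂ} {i : Fin k} {u : ℂ} :
    ThetaMutual k S i u ↔ u ∈ S ∧ ∃ w ∈ S, w - u ∈ thetaCone k i ∧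
      ∀ v ∈ S, v ∉ mutualBlock k u w := by
  have hk : 0 < k := i.pos
  constructor
  · rintro ⟨w, hw, hw'⟩
    have h1 := (thetaChooses_iff hw.2.2.1).1 hw
    have h2 := (exists_thetaChooses_iff hk).1 hw'
    exact ⟨h1.1, w, h1.2.1, hw.2.2.1, fun v hv => not_or.2 ⟨h1.2.2 v hv, h2.2.2.2 v hv⟩⟩
  · rintro ⟨hu, w, hw, hc, h⟩
    have hne : w ≠ u := by
      rintro rfl
      rw [sub_self] at hc
      exact zero_notMem_thetaCone i hc
    exact ⟨w, (thetaChooses_iff hc).2 ⟨hu, hw, fun v hv => (not_or.1 (h v hv)).1⟩,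
      (exists_thetaChooses_iff hk).2 ⟨hne, hw, hu, fun v hv => (not_or.1 (h v hv)).2⟩⟩

namespace IsBlocking

variable {k : ℕ} {B : ℂ → ℂ → Set ℂ}

theorem measurableSet_apply (hB : IsBlocking k B) (u w : ℂ) : MeasurableSet (B u w) :=
  measurableSet_preimage (f := fun v : ℂ => (u, w, v)) (by fun_prop) hB.measurableSet

theorem volume_add_right (hB : IsBlocking k B) (u w a : ℂ) :
    volume (B (u + a) (w + a)) = volume (B u w) := by
  rw [← measure_preimage_add_right volume a (B (u + a) (w + a))]
  congr 1
  ext v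
  exact hB.translate u w v a

open scoped Pointwise in
theorem volume_mul (hB : IsBlocking k B) {c : ℝ} (hc : 0 < c) (w : ℂ) :
    volume (B 0 (c * w)) = ENNReal.ofReal (c ^ 2) * volume (B 0 w) := by
  have : B 0 (c * w) = c • B 0 w := by
    ext v
    rw [Set.mem_smul_set_iff_inv_smul_mem₀ hc.ne', ← hB.scale c hc 0 w, mul_zero, Complex.real_smul,
      Complex.ofReal_inv, mul_inv_cancel_left₀ (by exact_mod_cast hc.ne')]
  rw [this, Measure.addHaar_smul, Complex.finrank_real_complex, abs_of_nonneg (by positivity)]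

theorem volume_lt_top (hB : IsBlocking k B) (u w : ℂ) : volume (B u w) < ⊤ :=
  (measure_mono (hB.subset_ball u w)).trans_lt measure_ball_lt_top

end IsBlocking

theorem thetaCone_inter_ball_subset_thetaBlock {k : ℕ} (hk : 3 ≤ k) {i : Fin k} {u w : ℂ}
    (hw : w - u ∈ thetaCone k i) {v : ℂ}
    (hv : v - u ∈ thetaCone k i ∩ Metric.ball 0 (‖w - u‖ / 2)) : v ∈ thetaBlock k u w := by
  refine ⟨i, hw, hv.1, ?_⟩
  have h1 := half_norm_le_thetaHeight hk hw
  have h2 := thetaHeight_le_norm i (v - u)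
  have h3 := mem_ball_zero_iff.1 hv.2
  linarith

/-- The block contains the sector of radius `ρ / 2` around `u`. Intersecting with a ball makes the
bound survive near the boundary: the ball may lie in the square when the whole block does not. -/
theorem le_volume_thetaBlock_inter {k : ℕ} (hk : 3 ≤ k) {u w : ℂ} {ρ : ℝ} (hρ : 0 < ρ)
    (hw : ρ ≤ ‖w - u‖) :
    ENNReal.ofReal (Real.pi * (ρ / 2) ^ 2 / k) ≤
      volume (thetaBlock k u w ∩ Metric.ball u ρ) := by
  obtain ⟨i, hi⟩ := exists_mem_thetaCone (by omega : 0 < k)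
    (norm_pos_iff.1 (hρ.trans_le hw))
  rw [← volume_thetaCone_inter_ball i (half_pos hρ),
    ← measure_preimage_add_right volume (-u) (thetaCone k i ∩ _)]
  refine measure_mono fun v hv => ?_
  rw [Set.mem_preimage, ← sub_eq_add_neg] at hv
  refine ⟨thetaCone_inter_ball_subset_thetaBlock hk hi
    ⟨hv.1, Metric.ball_subset_ball (by linarith) hv.2⟩, ?_⟩
  have := mem_ball_zero_iff.1 hv.2
  rw [Metric.mem_ball, dist_eq_norm]
  linarith

/-- A level line of the height is a translate of a proper subspace. Hence equal heights have
probability zero. -/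
theorem volume_thetaHeight_eq (k : ℕ) (i : Fin k) (x : ℝ) :
    volume {v : ℂ | thetaHeight k i v = x} = 0 := by
  have h1 : inner ℝ (thetaAxis k i) (thetaAxis k i) = (1 : ℝ) := by
    rw [real_inner_self_eq_norm_sq, norm_thetaAxis, one_pow]
  have h0 : volume ((LinearMap.ker (innerSL ℝ (thetaAxis k i)).toLinearMap : Submodule ℝ ℂ) : Set ℂ)
      = 0 := by
    refine Measure.addHaar_submodule _ _ fun htop => ?_
    have : thetaAxis k i ∈ LinearMap.ker (innerSL ℝ (thetaAxis k i)).toLinearMap := by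
      rw [htop]; trivial
    rw [LinearMap.mem_ker] at this
    exact one_ne_zero (h1.symm.trans this)
  rw [← measure_preimage_add_right volume (-(x • thetaAxis k i))] at h0
  refine measure_mono_null (fun v hv => ?_) h0
  have hv : inner ℝ (thetaAxis k i) v = x := hv
  change inner ℝ (thetaAxis k i) (v + -(x • thetaAxis k i)) = 0
  rw [inner_add_right, inner_neg_right, inner_smul_right, h1, hv, mul_one, add_neg_cancel]

/-! ### Exponential integrals and ranks -/

/-- Layer-cake formula: only the distribution of `G` matters. -/
theorem lintegral_exp_neg_eq_lintegral_log {α : Type*} [MeasurableSpace α] (μ : Measure α)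
    {G : α → ℝ} (hG : Measurable G) :
    ∫⁻ a, ENNReal.ofReal (Real.exp (-G a)) ∂μ
      = ∫⁻ t in Set.Ioi (0 : ℝ), μ {a | G a < -Real.log t} := by
  rw [lintegral_eq_lintegral_meas_lt μ (ae_of_all _ fun a => (Real.exp_pos _).le)
    (by fun_prop)]
  refine setLIntegral_congr_fun measurableSet_Ioi fun t ht => ?_
  congr 1
  ext a
  change t < _ ↔ G a < _
  rw [← Real.log_lt_iff_lt_exp ht, lt_neg]

/-- This is the layer-cake identity for the identity function on the half-line, where the left side
is the integral of exp(-x). For `t > 1` the truncation by `ENNReal.ofReal` makes the integrand zero.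
-/
theorem lintegral_ofReal_neg_log :
    ∫⁻ t in Set.Ioi (0 : ℝ), ENNReal.ofReal (-Real.log t) = 1 := by
  have h := lintegral_exp_neg_eq_lintegral_log (volume.restrict (Set.Ioi (0 : ℝ))) measurable_id
  simp only [id] at h
  rw [← ofReal_integral_eq_lintegral_ofReal (integrableOn_exp_neg_Ioi 0)
    (ae_of_all _ fun a => (Real.exp_pos _).le)] at h
  simp only [integral_exp_neg_Ioi_zero, ENNReal.ofReal_one] at h
  rw [h]
  refine setLIntegral_congr_fun measurableSet_Ioi fun t ht => ?_
  rw [Measure.restrict_apply (show MeasurableSet {a : ℝ | a < -Real.log t} from measurableSet_Iio)]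
  have : {a : ℝ | a < -Real.log t} ∩ Set.Ioi 0 = Set.Ioo 0 (-Real.log t) := by
    ext a
    exact and_comm
  rw [this, Real.volume_Ioo, sub_zero]

theorem lintegral_exp_neg_le_one {α : Type*} [MeasurableSpace α] {μ : Measure α}
    {G : α → ℝ} (hG : Measurable G) (h : ∀ s, μ {a | G a < s} ≤ ENNReal.ofReal s) :
    ∫⁻ a, ENNReal.ofReal (Real.exp (-G a)) ∂μ ≤ 1 := by
  rw [lintegral_exp_neg_eq_lintegral_log μ hG, ← lintegral_ofReal_neg_log]
  exact lintegral_mono fun t => h _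

theorem lintegral_exp_neg_eq_one {α : Type*} [MeasurableSpace α] {μ : Measure α}
    {G : α → ℝ} (hG : Measurable G) (h : ∀ s, μ {a | G a < s} = ENNReal.ofReal s) :
    ∫⁻ a, ENNReal.ofReal (Real.exp (-G a)) ∂μ = 1 := by
  rw [lintegral_exp_neg_eq_lintegral_log μ hG, ← lintegral_ofReal_neg_log]
  exact lintegral_congr fun t => h _

theorem lintegral_exp_neg_mul_le {α : Type*} [MeasurableSpace α] {μ : Measure α}
    {G : α → ℝ} (hG : Measurable G) (h : ∀ s, μ {a | G a < s} ≤ ENNReal.ofReal s) {c : ℝ}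
    (hc : 0 < c) :
    ∫⁻ a, ENNReal.ofReal (Real.exp (-(c * G a))) ∂μ ≤ ENNReal.ofReal (1 / c) := by
  -- Multiplying the measure by `c` restores the hypothesis for `c * G`.
  have := lintegral_exp_neg_le_one (μ := ENNReal.ofReal c • μ) (hG.const_mul c) fun s => by
    have e : {a | c * G a < s} = {a | G a < s / c} := by
      ext a
      exact (lt_div_iff₀' hc).symm
    rw [Measure.smul_apply, e, smul_eq_mul]
    refine (mul_le_mul_right (h _) _).trans ?_
    rw [← ENNReal.ofReal_mul hc.le, mul_div_cancel₀ _ hc.ne']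
  rw [lintegral_smul_measure, smul_eq_mul] at this
  rwa [ENNReal.ofReal_div_of_pos hc, ENNReal.ofReal_one,
    ENNReal.le_div_iff_mul_le (by simp [hc]) (by simp), mul_comm]

/-- A form of the probability integral transform. Were the set heavier than `s`, it would contain a
compact set `K` heavier than `s`; at the maximum `x` of `K`, the absence of atoms gives `s < μ K ≤ μ
(Set.Iio x)`, contradicting `x ∈ K`. -/
theorem measure_cdf_lt_le (μ : Measure ℝ) [IsFiniteMeasure μ] [NullSingletonClass μ] (s : ENNReal) :
    μ {x | μ (Set.Iio x) < s} ≤ s := by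
  by_contra! hlt
  have hmono : Monotone fun x => μ (Set.Iio x) := fun x y hxy =>
    measure_mono (Set.Iio_subset_Iio hxy)
  obtain ⟨K, hK, hKc, hsK⟩ := (measurableSet_lt hmono.measurable
    (measurable_const (a := s))).exists_lt_isCompact hlt
  rcases K.eq_empty_or_nonempty with rfl | hne
  · simp at hsK
  obtain ⟨x, hx, hmax⟩ := hKc.exists_isGreatest hne
  have h1 : μ K ≤ μ (Set.Iio x) := by
    rw [measure_congr Iio_ae_eq_Iic]
    exact measure_mono fun y hy => hmax hy
  exact absurd (hsK.trans_le h1) (not_lt.2 (hK hx).le)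

theorem measure_rank_lt_le {α : Type*} [MeasurableSpace α] (ν : Measure α) [IsFiniteMeasure ν]
    {h : α → ℝ} (hh : Measurable h) (hnull : ∀ x, ν {a | h a = x} = 0) (s : ENNReal) :
    ν {a | ν {b | h b < h a} < s} ≤ s := by
  have : NullSingletonClass (ν.map h) := ⟨fun x => by
    rw [Measure.map_apply hh (measurableSet_singleton x)]
    exact hnull x⟩
  have hmono : Monotone fun x => ν.map h (Set.Iio x) := fun x y hxy =>
    measure_mono (Set.Iio_subset_Iio hxy)
  have key := measure_cdf_lt_le (ν.map h) s
  rw [Measure.map_apply hh (measurableSet_lt hmono.measurable measurable_const)] at key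
  convert key using 3
  ext a
  simp only [Set.mem_preimage, Set.mem_ofPred_eq]
  rw [Measure.map_apply hh measurableSet_Iio]
  rfl

theorem thetaBlock_inter_eq {k : ℕ} {i : Fin k} {u w : ℂ} (hw : w - u ∈ thetaCone k i) (R : Set ℂ) :
    thetaBlock k u w ∩ R = {v | thetaHeight k i (v - u) < thetaHeight k i (w - u)} ∩
      ({v | v - u ∈ thetaCone k i} ∩ R) := by
  ext v
  constructor
  · rintro ⟨⟨j, hj, hv, hlt⟩, hR⟩
    obtain rfl := thetaCone_index_unique hw hj
    exact ⟨hlt, hv, hR⟩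
  · rintro ⟨hlt, hv, hR⟩
    exact ⟨⟨i, hw, hv, hlt⟩, hR⟩

theorem measurable_thetaHeight_sub (k : ℕ) (i : Fin k) (u : ℂ) :
    Measurable fun v => thetaHeight k i (v - u) :=
  (continuous_thetaHeight k i).measurable.comp (by fun_prop)

theorem measurableSet_sub_mem_thetaCone {k : ℕ} (i : Fin k) (u : ℂ) :
    MeasurableSet {v | v - u ∈ thetaCone k i} :=
  measurableSet_preimage (f := fun v => v - u) (by fun_prop) (measurableSet_thetaCone i)

theorem iUnion_sub_mem_thetaCone {k : ℕ} (hk : 0 < k) (u : ℂ) :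
    ⋃ i : Fin k, {v | v - u ∈ thetaCone k i} = {u}ᶜ := by
  ext v
  simp only [Set.mem_iUnion, Set.mem_ofPred_eq, Set.mem_compl_iff, Set.mem_singleton_iff]
  constructor
  · rintro ⟨i, hi⟩ rfl
    rw [sub_self] at hi
    exact zero_notMem_thetaCone i hi
  · exact fun h => exists_mem_thetaCone hk (sub_ne_zero.2 h)

theorem lintegral_eq_sum_thetaCone {k : ℕ} (hk : 0 < k) (u : ℂ) (R : Set ℂ) (f : ℂ → ENNReal) :
    ∫⁻ w in R, f w = ∑ i : Fin k, ∫⁻ w in {v | v - u ∈ thetaCone k i}, f w ∂(volume.restrict R) := by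
  have h : (⋃ i : Fin k, {v | v - u ∈ thetaCone k i}) =ᵐ[volume.restrict R] Set.univ := by
    rw [iUnion_sub_mem_thetaCone hk, ae_eq_univ, compl_compl]
    exact Measure.absolutelyContinuous_of_le Measure.restrict_le_self (by simp)
  rw [← tsum_fintype (L := .unconditional _), ← lintegral_iUnion
    (fun i => measurableSet_sub_mem_thetaCone i u), setLIntegral_congr h, Measure.restrict_univ]
  intro i j hij
  exact Set.disjoint_left.2 fun v hi hj => hij (thetaCone_index_unique hi hj)

/-- For `w` in a fixed cone, the area of its block within `R` is the rank of its height among the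
points of the cone within `R`. The rank bound therefore gives at most `1 / c` per cone, however `R`
cuts the cones. -/
theorem lintegral_exp_neg_thetaBlock_le {k : ℕ} (hk : 0 < k) (u : ℂ) {R : Set ℂ}
    (hfin : volume R < ⊤) {c : ℝ} (hc : 0 < c) :
    ∫⁻ w in R, ENNReal.ofReal (Real.exp (-(c * volume.real (thetaBlock k u w ∩ R))))
      ≤ ENNReal.ofReal (k / c) := by
  have : IsFiniteMeasure (volume.restrict R) := ⟨by simpa using hfin⟩
  have key : ∀ i : Fin k, ∫⁻ w in {v | v - u ∈ thetaCone k i},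
      ENNReal.ofReal (Real.exp (-(c * volume.real (thetaBlock k u w ∩ R)))) ∂(volume.restrict R)
      ≤ ENNReal.ofReal (1 / c) := by
    intro i
    have hC := measurableSet_sub_mem_thetaCone i u
    have hh := measurable_thetaHeight_sub k i u
    set ν := (volume.restrict R).restrict {v | v - u ∈ thetaCone k i} with hν
    have hνR : ν = volume.restrict ({v | v - u ∈ thetaCone k i} ∩ R) := Measure.restrict_restrict hC
    have hmono : Monotone fun x => ν {v | thetaHeight k i (v - u) < x} := fun x y hxy =>
      measure_mono fun v hv => lt_of_lt_of_le hv hxy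
    have hG : Measurable fun w =>
        (ν {v | thetaHeight k i (v - u) < thetaHeight k i (w - u)}).toReal :=
      (hmono.measurable.comp hh).ennreal_toReal
    refine le_trans (le_of_eq ?_) (lintegral_exp_neg_mul_le (μ := ν) hG (fun s => ?_) hc)
    · refine setLIntegral_congr_fun hC fun w hw => ?_
      rw [thetaBlock_inter_eq hw, hνR, Measure.restrict_apply (measurableSet_lt hh measurable_const),
        measureReal_def]
    · refine le_trans (le_of_eq ?_) (measure_rank_lt_le ν hh (fun x => ?_) (ENNReal.ofReal s))
      · congr 1
        ext w
        exact (ENNReal.lt_ofReal_iff_toReal_lt (measure_ne_top _ _)).symm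
      · rw [hνR]
        refine measure_mono_null (fun v hv => hv) (Measure.absolutelyContinuous_of_le
          Measure.restrict_le_self ?_)
        have := volume_thetaHeight_eq k i x
        rwa [← measure_preimage_add_right volume (-u)] at this
  rw [lintegral_eq_sum_thetaCone hk u]
  refine (Finset.sum_le_sum fun i _ => key i).trans (le_of_eq ?_)
  rw [Finset.sum_const, Finset.card_univ, Fintype.card_fin, nsmul_eq_mul, ← ENNReal.ofReal_natCast,
    ← ENNReal.ofReal_mul (Nat.cast_nonneg k), mul_one_div]

open scoped Pointwise in
theorem volume_thetaCone_inter_height_lt {k : ℕ} (i : Fin k) {x : ℝ} (hx : 0 < x) :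
    volume (thetaCone k i ∩ {v | thetaHeight k i v < x})
      = ENNReal.ofReal (x ^ 2) * volume (thetaCone k i ∩ {v | thetaHeight k i v < 1}) := by
  have : thetaCone k i ∩ {v | thetaHeight k i v < x}
      = x • (thetaCone k i ∩ {v | thetaHeight k i v < 1}) := by
    ext v
    rw [Set.mem_smul_set_iff_inv_smul_mem₀ hx.ne', Complex.real_smul, Set.mem_inter_iff,
      Set.mem_inter_iff, thetaCone_mul_pos i (inv_pos.2 hx)]
    simp only [Set.mem_ofPred_eq]
    rw [thetaHeight_mul_ofReal, inv_mul_lt_one₀ hx]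
  rw [this, Measure.addHaar_smul, Complex.finrank_real_complex, abs_of_nonneg (by positivity)]

/-- In a full cone the area of the block is `t * height ^ 2`, with `t` the area below height 1, and
the set where this is less than `s > 0` has area exactly `s`. So each cone contributes 1: a typical
point expects one choice per cone. -/
theorem lintegral_exp_neg_thetaBlock {k : ℕ} (hk : 3 ≤ k) :
    ∫⁻ w, ENNReal.ofReal (Real.exp (-volume.real (thetaBlock k 0 w))) = k := by
  have key : ∀ i : Fin k, ∫⁻ w in {v | v - 0 ∈ thetaCone k i},
      ENNReal.ofReal (Real.exp (-volume.real (thetaBlock k 0 w)))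
      = 1 := by
    intro i
    have hC := measurableSet_thetaCone i
    have hh := (continuous_thetaHeight k i).measurable
    set T := thetaCone k i ∩ {v | thetaHeight k i v < 1} with hT
    have hT0 : 0 < volume T := by
      refine lt_of_lt_of_le ?_ (measure_mono (Set.inter_subset_inter_right _ fun v hv => ?_) :
        volume (thetaCone k i ∩ Metric.ball 0 1) ≤ volume T)
      · rw [volume_thetaCone_inter_ball i one_pos]
        have := Real.pi_pos
        have : (0 : ℝ) < k := Nat.cast_pos.2 i.pos
        simp only [ENNReal.ofReal_pos]
        positivity
      · exact (thetaHeight_le_norm i v).trans_lt (mem_ball_zero_iff.1 hv)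
    have hTfin : volume T < ⊤ := by
      refine (measure_mono fun v hv => ?_ : volume T ≤ volume (Metric.ball (0 : ℂ) 2)).trans_lt
        measure_ball_lt_top
      have h1 := half_norm_le_thetaHeight hk hv.1
      have h2 : thetaHeight k i v < 1 := hv.2
      rw [mem_ball_zero_iff]
      linarith
    set t := volume.real T with ht
    have ht0 : 0 < t := ENNReal.toReal_pos hT0.ne' hTfin.ne
    have hpos : ∀ w ∈ thetaCone k i, 0 < thetaHeight k i w := fun w hw =>
      lt_of_lt_of_le (by have := norm_pos_iff.2 ((mem_thetaCone_iff i w).1 hw).1; positivity)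
        (half_norm_le_thetaHeight hk hw)
    simp only [sub_zero]
    change ∫⁻ w in thetaCone k i, _ = 1
    have hG : Measurable fun w => t * thetaHeight k i w ^ 2 := by fun_prop
    rw [← lintegral_exp_neg_eq_one (μ := volume.restrict (thetaCone k i)) hG fun s => ?_]
    · refine setLIntegral_congr_fun hC fun w hw => ?_
      have e := thetaBlock_inter_eq (k := k) (i := i) (u := 0) (w := w) (by simpa using hw) Set.univ
      simp only [sub_zero, Set.inter_univ] at e
      rw [e, Set.inter_comm, measureReal_def]
      have := volume_thetaCone_inter_height_lt i (hpos w hw)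
      change volume ({v | v ∈ thetaCone k i} ∩ _) = _ at this
      rw [this, ENNReal.toReal_mul, ENNReal.toReal_ofReal (by positivity), mul_comm]
      rfl
    · rw [Measure.restrict_apply (measurableSet_lt hG measurable_const), Set.inter_comm]
      rcases le_or_gt s 0 with hs | hs
      · rw [ENNReal.ofReal_of_nonpos hs]
        convert measure_empty (μ := volume)
        refine Set.eq_empty_of_forall_notMem fun w hw => ?_
        have h2 : t * thetaHeight k i w ^ 2 < s := hw.2
        have : 0 ≤ t * thetaHeight k i w ^ 2 := by positivity
        linarith
      · have e : thetaCone k i ∩ {w | t * thetaHeight k i w ^ 2 < s}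
            = thetaCone k i ∩ {w | thetaHeight k i w < Real.sqrt (s / t)} := by
          ext w
          refine and_congr_right fun hw => ?_
          simp only [Set.mem_ofPred_eq]
          rw [Real.lt_sqrt (hpos w hw).le, lt_div_iff₀' ht0]
        rw [e, volume_thetaCone_inter_height_lt i (Real.sqrt_pos.2 (by positivity)),
          Real.sq_sqrt (by positivity), ← hT, ← ENNReal.ofReal_toReal hTfin.ne]
        change _ * ENNReal.ofReal t = _
        rw [← ENNReal.ofReal_mul (by positivity), div_mul_cancel₀ _ ht0.ne']
  rw [← setLIntegral_univ, lintegral_eq_sum_thetaCone (by omega : 0 < k) 0, Measure.restrict_univ,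
    Finset.sum_congr rfl fun i _ => key i]
  simp

/-! ### Resampling in product measures -/

/-- Resampling a coordinate in a way that preserves its law preserves a product measure. -/
theorem map_update_infinitePi {ι : Type*} [DecidableEq ι] {X : ι → Type*}
    [∀ i, MeasurableSpace (X i)] (μ : ∀ i, Measure (X i)) [∀ i, IsProbabilityMeasure (μ i)]
    {Y : Type*} [MeasurableSpace Y] (ν : Measure Y) [IsProbabilityMeasure ν] (c : ι)
    {g : X c × Y → X c} (hg : Measurable g) (hmap : ((μ c).prod ν).map g = μ c) :
    ((Measure.infinitePi μ).prod ν).map (fun p => Function.update p.1 c (g (p.1 c, p.2)))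
      = Measure.infinitePi μ := by
  have hmeas : Measurable fun p : (∀ i, X i) × Y => Function.update p.1 c (g (p.1 c, p.2)) :=
    measurable_update'.comp (measurable_fst.prodMk
      (hg.comp (((measurable_pi_apply c).comp measurable_fst).prodMk measurable_snd)))
  refine Measure.eq_infinitePi μ fun s t ht => ?_
  have hbox : MeasurableSet (Set.pi (s : Set ι) t) :=
    MeasurableSet.pi s.countable_toSet fun i _ => ht i
  rw [Measure.map_apply hmeas hbox, Measure.prod_apply_symm (hmeas hbox)]
  by_cases hc : c ∈ s
  · have h1 : ∀ y, (fun ω => (ω, y)) ⁻¹' ((fun p : (∀ i, X i) × Y =>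
        Function.update p.1 c (g (p.1 c, p.2))) ⁻¹' Set.pi (s : Set ι) t)
        = Set.pi (s : Set ι) (Function.update t c ((fun z => g (z, y)) ⁻¹' t c)) := by
      intro y
      ext ω
      simp only [Set.mem_preimage, Set.mem_pi]
      refine forall₂_congr fun i hi => ?_
      rcases eq_or_ne i c with rfl | hne
      · simp
      · simp [hne]
    have h2 : ∀ y, Measure.infinitePi μ
        (Set.pi (s : Set ι) (Function.update t c ((fun z => g (z, y)) ⁻¹' t c)))
        = μ c ((fun z => g (z, y)) ⁻¹' t c) * ∏ i ∈ s.erase c, μ i (t i) := by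
      intro y
      rw [Measure.infinitePi_pi]
      · rw [← Finset.mul_prod_erase s _ hc, Function.update_self]
        congr 1
        refine Finset.prod_congr rfl fun i hi => ?_
        rw [Function.update_of_ne (Finset.ne_of_mem_erase hi)]
      · intro i _
        rcases eq_or_ne i c with rfl | hne
        · rw [Function.update_self]
          exact measurableSet_preimage (by fun_prop) (ht i)
        · rw [Function.update_of_ne hne]
          exact ht i
    simp_rw [h1, h2]
    have h3 : Measurable fun y => μ c ((fun z => g (z, y)) ⁻¹' t c) :=
      measurable_measure_prodMk_right (hg (ht c))
    rw [lintegral_mul_const _ h3,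
      ← Finset.mul_prod_erase s _ hc]
    congr 1
    nth_rw 2 [← hmap]
    rw [Measure.map_apply hg (ht c), Measure.prod_apply_symm (hg (ht c))]
    rfl
  · have h1 : ∀ y, (fun ω => (ω, y)) ⁻¹' ((fun p : (∀ i, X i) × Y =>
        Function.update p.1 c (g (p.1 c, p.2))) ⁻¹' Set.pi (s : Set ι) t)
        = Set.pi (s : Set ι) t := by
      intro y
      ext ω
      simp only [Set.mem_preimage, Set.mem_pi]
      refine forall₂_congr fun i hi => ?_
      have hne : i ≠ c := fun h => hc (h ▸ hi)
      simp [hne]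
    simp_rw [h1]
    rw [lintegral_const, measure_univ, mul_one, Measure.infinitePi_pi μ fun i _ => ht i]

theorem infinitePi_apply_eq_lintegral_update {ι : Type*} [DecidableEq ι] {X : ι → Type*}
    [∀ i, MeasurableSpace (X i)] (μ : ∀ i, Measure (X i)) [∀ i, IsProbabilityMeasure (μ i)]
    (c : ι) {E : Set (∀ i, X i)} (hE : MeasurableSet E) :
    Measure.infinitePi μ E
      = ∫⁻ x, Measure.infinitePi μ {ω | Function.update ω c x ∈ E} ∂(μ c) := by
  have hmap : ((μ c).prod (μ c)).map Prod.snd = μ c := by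
    rw [Measure.map_snd_prod, measure_univ, one_smul]
  have h := map_update_infinitePi μ (μ c) c measurable_snd hmap
  nth_rw 1 [← h]
  have hmeas : Measurable fun p : (∀ i, X i) × X c => Function.update p.1 c p.2 :=
    measurable_update'
  rw [Measure.map_apply hmeas hE, Measure.prod_apply_symm (hmeas hE)]
  rfl

theorem infinitePi_eq_zero_of_update {ι : Type*} [DecidableEq ι] {X : ι → Type*}
    [∀ i, MeasurableSpace (X i)] (μ : ∀ i, Measure (X i)) [∀ i, IsProbabilityMeasure (μ i)]
    (c : ι) {E : Set (∀ i, X i)} (hE : MeasurableSet E)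
    (h : ∀ ω, μ c {x | Function.update ω c x ∈ E} = 0) : Measure.infinitePi μ E = 0 := by
  have hmap : ((μ c).prod (μ c)).map Prod.snd = μ c := by
    rw [Measure.map_snd_prod, measure_univ, one_smul]
  have hmeas : Measurable fun p : (∀ i, X i) × X c => Function.update p.1 c p.2 :=
    measurable_update'
  rw [← map_update_infinitePi μ (μ c) c measurable_snd hmap, Measure.map_apply hmeas hE,
    Measure.measure_prod_null (hmeas hE)]
  exact ae_of_all _ h

theorem measurableSet_forall_notMem_block {ι α : Type*} [Countable ι] [MeasurableSpace α]
    {B : α → α → Set α} (hB : MeasurableSet {p : α × α × α | p.2.2 ∈ B p.1 p.2.1}) (a b : ι) :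
    MeasurableSet {x : ι → α | ∀ c, x c ∉ B (x a) (x b)} := by
  have : {x : ι → α | ∀ c, x c ∉ B (x a) (x b)} = ⋂ c,
      ((fun x : ι → α => (x a, x b, x c)) ⁻¹' {p : α × α × α | p.2.2 ∈ B p.1 p.2.1})ᶜ := by
    ext x
    simp
  rw [this]
  exact MeasurableSet.iInter fun c => (measurableSet_preimage (by fun_prop) hB).compl

/-- Given the positions of the points `a` and `b`, the others avoid the region independently. -/
theorem infinitePi_forall_notMem_block {ι α : Type*} [Fintype ι] [DecidableEq ι]
    [MeasurableSpace α] (μ : Measure α) [IsProbabilityMeasure μ] {B : α → α → Set α}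
    (hB : MeasurableSet {p : α × α × α | p.2.2 ∈ B p.1 p.2.1})
    (hl : ∀ u w, u ∉ B u w) (hr : ∀ u w, w ∉ B u w) {a b : ι} (hab : a ≠ b) :
    Measure.infinitePi (fun _ : ι => μ) {x | ∀ c, x c ∉ B (x a) (x b)}
      = ∫⁻ u, ∫⁻ w, μ (B u w)ᶜ ^ (Fintype.card ι - 2) ∂μ ∂μ := by
  have hE := measurableSet_forall_notMem_block hB a b
  rw [infinitePi_apply_eq_lintegral_update _ a hE]
  refine lintegral_congr fun u => ?_
  rw [infinitePi_apply_eq_lintegral_update _ b (show MeasurableSet {ω : ι → α |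
    Function.update ω a u ∈ {x | ∀ c, x c ∉ B (x a) (x b)}} from measurable_update_left hE)]
  refine lintegral_congr fun w => ?_
  have hm : MeasurableSet (B u w) :=
    measurableSet_preimage (f := fun v : α => (u, w, v)) (by fun_prop) hB
  have : {ω : ι → α | Function.update ω b w ∈ {ω | Function.update ω a u ∈
      {x | ∀ c, x c ∉ B (x a) (x b)}}} =
      Set.pi ((Finset.univ.erase a).erase b : Finset ι) fun _ => (B u w)ᶜ := by
    ext ω
    simp only [Set.mem_ofPred_eq, Set.mem_pi, Function.update_self, Finset.mem_coe,
      Finset.mem_erase, Finset.mem_univ, and_true, Set.mem_compl_iff]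
    rw [Function.update_of_ne hab.symm, Function.update_self]
    -- The indices `a` and `b` impose no condition, by `hl` and `hr`, which leaves `Fintype.card ι -
    -- 2` factors.
    refine forall_congr' fun c => ?_
    rcases eq_or_ne c a with rfl | hca
    · simp [hl]
    rcases eq_or_ne c b with rfl | hcb
    · simp [hca, hr]
    · simp [hca, hcb]
  rw [this, Measure.infinitePi_pi _ fun _ _ => hm.compl, Finset.prod_const,
    Finset.card_erase_of_mem (by simp [hab.symm]), Finset.card_erase_of_mem (by simp),
    Finset.card_univ]
  rfl

/-! ### The Poisson process, cell by cell, and Mecke's formula -/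

/-- A point at position `x` in the unit square, moved to the lattice cell `c`. -/
noncomputable def cellPoint (c : ℤ × ℤ) (x : ℂ) : ℂ :=
  ((c.1 : ℝ) : ℂ) + ((c.2 : ℝ) : ℂ) * Complex.I + x

theorem measurable_cellPoint (c : ℤ × ℤ) : Measurable (cellPoint c) := by
  unfold cellPoint
  fun_prop

/-- The configuration `ω` with its `j`-th candidate position in the cell `c` replaced by `x`. -/
def resample (c : ℤ × ℤ) (j : ℕ) (ω : PoissonSpace) (x : ℂ) : PoissonSpace :=
  Function.update ω c ((ω c).1, Function.update (ω c).2 j x)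

instance : IsProbabilityMeasure poissonLaw := by
  unfold poissonLaw
  infer_instance

theorem measurable_resample (c : ℤ × ℤ) (j : ℕ) :
    Measurable fun p : PoissonSpace × ℂ => resample c j p.1 p.2 := by
  have h : Measurable fun p : (ℕ → ℂ) × ℂ => Function.update p.1 j p.2 := measurable_update'
  refine measurable_update'.comp (measurable_fst.prodMk ?_)
  fun_prop

theorem map_resample (c : ℤ × ℤ) (j : ℕ) :
    (poissonLaw.prod uniformSquare).map (fun p => resample c j p.1 p.2) = poissonLaw := by
  have h : Measurable fun p : (ℕ → ℂ) × ℂ => Function.update p.1 j p.2 := measurable_update'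
  have hup : ((Measure.infinitePi fun _ : ℕ => uniformSquare).prod uniformSquare).map
      (fun p => Function.update p.1 j p.2) = Measure.infinitePi fun _ : ℕ => uniformSquare :=
    map_update_infinitePi (fun _ : ℕ => uniformSquare) uniformSquare j
      (g := Prod.snd) measurable_snd (by rw [Measure.map_snd_prod, measure_univ, one_smul])
  refine map_update_infinitePi (fun _ : ℤ × ℤ => (poissonMeasure 1).prod
    (Measure.infinitePi fun _ : ℕ => uniformSquare)) uniformSquare c
    (g := fun p => (p.1.1, Function.update p.1.2 j p.2)) (by fun_prop) ?_
  have hmp : MeasurePreserving (fun p : (ℕ × (ℕ → ℂ)) × ℂ => (p.1.1, (p.1.2, p.2)))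
      (((poissonMeasure 1).prod (Measure.infinitePi fun _ : ℕ => uniformSquare)).prod uniformSquare)
      ((poissonMeasure 1).prod
        ((Measure.infinitePi fun _ : ℕ => uniformSquare).prod uniformSquare)) :=
    measurePreserving_prodAssoc _ _ _
  exact (((MeasurePreserving.id (poissonMeasure 1)).prod ⟨h, hup⟩).comp hmp).map_eq

theorem poissonLaw_apply_eq_lintegral_resample (c : ℤ × ℤ) (j : ℕ) {E : Set PoissonSpace}
    (hE : MeasurableSet E) :
    poissonLaw E = ∫⁻ x, poissonLaw {ω | resample c j ω x ∈ E} ∂uniformSquare := by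
  nth_rw 1 [← map_resample c j]
  rw [Measure.map_apply (measurable_resample c j) hE,
    Measure.prod_apply_symm (measurable_resample c j hE)]
  rfl

theorem measurableSet_unitSquare : MeasurableSet unitSquare :=
  (measurableSet_preimage Complex.measurable_re measurableSet_Icc).inter
    (measurableSet_preimage Complex.measurable_im measurableSet_Icc)

theorem uniformSquare_eq : uniformSquare = volume.restrict unitSquare := by
  rw [uniformSquare, ProbabilityTheory.cond, volume_unitSquare, inv_one, one_smul]

theorem volume_re_eq (a : ℝ) : volume {z : ℂ | z.re = a} = 0 := by
  have h : {z : ℂ | z.re = a} = Complex.measurableEquivRealProd ⁻¹' ({a} ×ˢ Set.univ) := by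
    ext z
    simp [Complex.measurableEquivRealProd_apply]
  rw [h, Complex.volume_preserving_equiv_real_prod.measure_preimage_equiv,
    Measure.volume_eq_prod, Measure.prod_prod]
  simp

theorem volume_im_eq (a : ℝ) : volume {z : ℂ | z.im = a} = 0 := by
  have h : {z : ℂ | z.im = a} = Complex.measurableEquivRealProd ⁻¹' (Set.univ ×ˢ {a}) := by
    ext z
    simp [Complex.measurableEquivRealProd_apply]
  rw [h, Complex.volume_preserving_equiv_real_prod.measure_preimage_equiv,
    Measure.volume_eq_prod, Measure.prod_prod]
  simp

/-- The half-open lattice cell with index `c`. -/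
def latticeCell (c : ℤ × ℤ) : Set ℂ := {z | ⌊z.re⌋ = c.1 ∧ ⌊z.im⌋ = c.2}

theorem measurableSet_latticeCell (c : ℤ × ℤ) : MeasurableSet (latticeCell c) :=
  (measurableSet_eq_fun (Int.measurable_floor.comp Complex.measurable_re) measurable_const).inter
    (measurableSet_eq_fun (Int.measurable_floor.comp Complex.measurable_im) measurable_const)

theorem iUnion_latticeCell : ⋃ c, latticeCell c = Set.univ :=
  Set.eq_univ_of_forall fun z => Set.mem_iUnion.2 ⟨(⌊z.re⌋, ⌊z.im⌋), rfl, rfl⟩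

theorem pairwise_disjoint_latticeCell : Pairwise (Function.onFun Disjoint latticeCell) :=
  fun _ _ hcd => Set.disjoint_left.2 fun _ hc hd =>
    hcd (Prod.ext (hc.1.symm.trans hd.1) (hc.2.symm.trans hd.2))

/-- The closed square may be replaced by the half-open cell, since the edges are null; the half-open
cells partition the plane. -/
theorem uniformSquare_eq_latticeCell : uniformSquare = volume.restrict (latticeCell 0) := by
  rw [uniformSquare_eq]
  refine Measure.restrict_congr_set ?_
  have h1 : ∀ᵐ z : ℂ, z.re ≠ 1 := by
    simpa [ae_iff] using volume_re_eq 1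
  have h2 : ∀ᵐ z : ℂ, z.im ≠ 1 := by
    simpa [ae_iff] using volume_im_eq 1
  filter_upwards [h1, h2] with z hz hz'
  apply propext
  change (z.re ∈ Set.Icc (0 : ℝ) 1 ∧ z.im ∈ Set.Icc (0 : ℝ) 1) ↔ (⌊z.re⌋ = 0 ∧ ⌊z.im⌋ = 0)
  rw [Int.floor_eq_zero_iff, Int.floor_eq_zero_iff]
  simp only [Set.mem_Icc, Set.mem_Ico]
  constructor
  · rintro ⟨⟨a, b⟩, c, d⟩
    exact ⟨⟨a, lt_of_le_of_ne b hz⟩, c, lt_of_le_of_ne d hz'⟩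
  · rintro ⟨⟨a, b⟩, c, d⟩
    exact ⟨⟨a, b.le⟩, c, d.le⟩

theorem cellPoint_mem_latticeCell (c : ℤ × ℤ) (x : ℂ) :
    cellPoint c x ∈ latticeCell c ↔ x ∈ latticeCell 0 := by
  simp [cellPoint, latticeCell]

theorem setLIntegral_latticeCell (c : ℤ × ℤ) (f : ℂ → ENNReal) :
    ∫⁻ z in latticeCell c, f z = ∫⁻ x, f (cellPoint c x) ∂uniformSquare := by
  rw [uniformSquare_eq_latticeCell, ← lintegral_indicator (measurableSet_latticeCell _),
    ← lintegral_indicator (measurableSet_latticeCell _),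
    ← lintegral_add_left_eq_self _ (((c.1 : ℝ) : ℂ) + ((c.2 : ℝ) : ℂ) * Complex.I)]
  refine lintegral_congr fun x => ?_
  change (latticeCell c).indicator f (cellPoint c x) = _
  by_cases hx : x ∈ latticeCell 0
  · rw [Set.indicator_of_mem hx, Set.indicator_of_mem ((cellPoint_mem_latticeCell c x).2 hx)]
  · rw [Set.indicator_of_notMem hx,
      Set.indicator_of_notMem (mt (cellPoint_mem_latticeCell c x).1 hx)]

theorem lintegral_eq_tsum_cellPoint (f : ℂ → ENNReal) :
    ∫⁻ z, f z = ∑' c : ℤ × ℤ, ∫⁻ x, f (cellPoint c x) ∂uniformSquare := by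
  simp_rw [← setLIntegral_latticeCell]
  rw [← lintegral_iUnion measurableSet_latticeCell pairwise_disjoint_latticeCell,
    iUnion_latticeCell, setLIntegral_univ]

theorem volume_eq_tsum_cellPoint {A : Set ℂ} (hA : MeasurableSet A) :
    volume A = ∑' c : ℤ × ℤ, uniformSquare {x | cellPoint c x ∈ A} := by
  rw [← lintegral_indicator_one hA, lintegral_eq_tsum_cellPoint]
  refine tsum_congr fun c => ?_
  rw [← lintegral_indicator_one (show MeasurableSet {x | cellPoint c x ∈ A} from
      measurable_cellPoint c hA)]
  rfl

theorem uniformSquare_cellPoint_mem {A : Set ℂ} (hA : MeasurableSet A) (c : ℤ × ℤ) :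
    uniformSquare {x | cellPoint c x ∈ A} = volume (A ∩ latticeCell c) := by
  have := setLIntegral_latticeCell c (A.indicator 1)
  rw [lintegral_indicator_one hA, Measure.restrict_apply hA] at this
  rw [this, ← lintegral_indicator_one (show MeasurableSet {x | cellPoint c x ∈ A} from
      measurable_cellPoint c hA)]
  rfl

theorem finite_latticeCell_inter_ball (R : ℝ) :
    {c : ℤ × ℤ | (Metric.ball (0 : ℂ) R ∩ latticeCell c).Nonempty}.Finite := by
  refine ((Set.finite_Icc (⌊-R⌋) ⌊R⌋).prod (Set.finite_Icc (⌊-R⌋) ⌊R⌋)).subset ?_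
  rintro c ⟨z, hz, h1, h2⟩
  have hz := mem_ball_zero_iff.1 hz
  have hr := abs_le.1 ((Complex.abs_re_le_norm z).trans hz.le)
  have hi := abs_le.1 ((Complex.abs_im_le_norm z).trans hz.le)
  rw [Set.mem_prod, ← h1, ← h2]
  exact ⟨⟨Int.floor_le_floor hr.1, Int.floor_le_floor hr.2⟩,
    ⟨Int.floor_le_floor hi.1, Int.floor_le_floor hi.2⟩⟩

/-- The law of the number of points and the candidate positions in one lattice cell. -/
noncomputable def cellLaw : Measure (ℕ × (ℕ → ℂ)) :=
  (poissonMeasure 1).prod (Measure.infinitePi fun _ : ℕ => uniformSquare)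

instance : IsProbabilityMeasure cellLaw := by
  unfold cellLaw
  infer_instance

theorem cellLaw_apply {E : Set (ℕ × (ℕ → ℂ))} (hE : MeasurableSet E) :
    cellLaw E = ∑' m : ℕ, ENNReal.ofReal (Real.exp (-1) / (m.factorial : ℝ)) *
      Measure.infinitePi (fun _ : ℕ => uniformSquare) {X | (m, X) ∈ E} := by
  rw [cellLaw, Measure.prod_apply hE, lintegral_countable']
  refine tsum_congr fun m => ?_
  rw [poissonMeasure_singleton, mul_comm]
  simp
  rfl

theorem infinitePi_forall_mem_finset (s : Finset ℕ) {U : Set ℂ} (hU : MeasurableSet U) :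
    Measure.infinitePi (fun _ : ℕ => uniformSquare) {X | ∀ j ∈ s, X j ∈ U}
      = uniformSquare U ^ s.card := by
  have : {X : ℕ → ℂ | ∀ j ∈ s, X j ∈ U} = Set.pi (s : Set ℕ) fun _ => U := by
    ext X
    simp [Set.mem_pi]
  rw [this, Measure.infinitePi_pi _ fun _ _ => hU, Finset.prod_const]

/-- The probability generating function of the Poisson law of mean 1. -/
theorem tsum_exp_neg_one_mul_pow {q : ℝ} (hq : 0 ≤ q) :
    ∑' m : ℕ, ENNReal.ofReal (Real.exp (-1) / (m.factorial : ℝ)) * ENNReal.ofReal q ^ m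
      = ENNReal.ofReal (Real.exp (-(1 - q))) := by
  have h : HasSum (fun m : ℕ => Real.exp (-1) / (m.factorial : ℝ) * q ^ m)
      (Real.exp (-(1 - q))) := by
    have := (NormedSpace.expSeries_div_hasSum_exp (𝔸 := ℝ) q).mul_left (Real.exp (-1))
    rw [← Real.exp_eq_exp_ℝ, ← Real.exp_add] at this
    have e1 : (fun m : ℕ => Real.exp (-1) / (m.factorial : ℝ) * q ^ m)
        = fun m : ℕ => Real.exp (-1) * (q ^ m / (m.factorial : ℝ)) := by
      funext m
      ring
    rw [e1, show -(1 - q) = -1 + q by ring]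
    exact this
  rw [← h.tsum_eq, ENNReal.ofReal_tsum_of_nonneg (fun m => by positivity) h.summable]
  refine tsum_congr fun m => ?_
  rw [ENNReal.ofReal_mul (by positivity), ENNReal.ofReal_pow hq]

theorem measurableSet_forall_lt_mem {U : Set ℂ} (hU : MeasurableSet U) (p : ℕ → Prop) :
    MeasurableSet {ξ : ℕ × (ℕ → ℂ) | ∀ j, j < ξ.1 → p j → ξ.2 j ∈ U} := by
  have : {ξ : ℕ × (ℕ → ℂ) | ∀ j, j < ξ.1 → p j → ξ.2 j ∈ U}
      = ⋂ j : ℕ, ({ξ | j < ξ.1}ᶜ ∪ ({ξ | p j}ᶜ ∪ (fun ξ : ℕ × (ℕ → ℂ) => ξ.2 j) ⁻¹' U)) := by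
    ext ξ
    simp only [Set.mem_ofPred_eq, Set.mem_iInter, Set.mem_union, Set.mem_compl_iff,
      Set.mem_preimage]
    exact forall_congr' fun j => by tauto
  rw [this]
  refine MeasurableSet.iInter fun j => (measurableSet_lt measurable_const measurable_fst).compl.union
    ((MeasurableSet.const _).compl.union (measurableSet_preimage (by fun_prop) hU))

theorem cellLaw_forall_mem {U : Set ℂ} (hU : MeasurableSet U) :
    cellLaw {ξ | ∀ j, j < ξ.1 → ξ.2 j ∈ U}
      = ENNReal.ofReal (Real.exp (-(1 - uniformSquare.real U))) := by
  have hm := measurableSet_forall_lt_mem hU fun _ => True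
  simp only [forall_const] at hm
  rw [cellLaw_apply hm, ← tsum_exp_neg_one_mul_pow measureReal_nonneg]
  refine tsum_congr fun m => ?_
  congr 1
  have := infinitePi_forall_mem_finset (Finset.range m) hU
  simp only [Finset.mem_range, Finset.card_range] at this
  rw [ofReal_measureReal]
  exact this

/-- The Palm property in one cell: with `m` points there are `m` choices of the exempt one, and `m /
m! = 1 / (m - 1)!` shifts the series back to the plain void probability. -/
theorem tsum_cellLaw_forall_ne_mem {U : Set ℂ} (hU : MeasurableSet U) :
    ∑' j, cellLaw {ξ | j < ξ.1 ∧ ∀ j', j' < ξ.1 → j' ≠ j → ξ.2 j' ∈ U}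
      = ENNReal.ofReal (Real.exp (-(1 - uniformSquare.real U))) := by
  have hm : ∀ j, MeasurableSet
      {ξ : ℕ × (ℕ → ℂ) | j < ξ.1 ∧ ∀ j', j' < ξ.1 → j' ≠ j → ξ.2 j' ∈ U} := fun j =>
    (measurableSet_lt measurable_const measurable_fst).inter
      (measurableSet_forall_lt_mem hU fun j' => j' ≠ j)
  have h1 : ∀ j m, Measure.infinitePi (fun _ : ℕ => uniformSquare)
      {X | (m, X) ∈ {ξ : ℕ × (ℕ → ℂ) | j < ξ.1 ∧ ∀ j', j' < ξ.1 → j' ≠ j → ξ.2 j' ∈ U}}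
      = if j < m then uniformSquare U ^ (m - 1) else 0 := by
    intro j m
    split_ifs with hj
    · have := infinitePi_forall_mem_finset ((Finset.range m).erase j) hU
      rw [Finset.card_erase_of_mem (Finset.mem_range.2 hj), Finset.card_range] at this
      rw [← this]
      congr 1
      ext X
      simp only [Set.mem_ofPred_eq, hj, true_and, Finset.mem_erase, Finset.mem_range]
      exact forall_congr' fun j' => by tauto
    · simp [hj]
  simp_rw [fun j => cellLaw_apply (hm j), h1]
  rw [ENNReal.tsum_comm]
  have h2 : ∀ m : ℕ, ∑' j : ℕ, ENNReal.ofReal (Real.exp (-1) / (m.factorial : ℝ)) *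
      (if j < m then uniformSquare U ^ (m - 1) else 0)
      = ENNReal.ofReal (Real.exp (-1) / (m.factorial : ℝ)) * (m * uniformSquare U ^ (m - 1)) := by
    intro m
    rw [ENNReal.tsum_mul_left, tsum_eq_sum (s := Finset.range m)
      (fun j hj => if_neg fun h => hj (Finset.mem_range.2 h)),
      Finset.sum_congr rfl fun j hj => if_pos (Finset.mem_range.1 hj)]
    simp
  simp_rw [h2]
  -- The term `m = 0` vanishes because of its factor `m`, so the truncated exponent `m - 1` does no
  -- harm.
  rw [tsum_eq_zero_add' ENNReal.summable, ← tsum_exp_neg_one_mul_pow measureReal_nonneg]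
  simp only [Nat.cast_zero, zero_mul, mul_zero, zero_add, Nat.add_sub_cancel]
  refine tsum_congr fun m => ?_
  rw [ofReal_measureReal, ← mul_assoc, ← ENNReal.ofReal_natCast,
    ← ENNReal.ofReal_mul (by positivity)]
  congr 2
  rw [Nat.factorial_succ]
  push_cast
  field_simp

theorem poissonLaw_eq : poissonLaw = Measure.infinitePi fun _ : ℤ × ℤ => cellLaw := rfl

/-- A bounded region meets finitely many cells, so the infinite product of void probabilities is
finite in effect. Exempting one point of the cell `c` and summing over it leaves the product
unchanged, by the Palm property. -/
theorem tsum_poissonLaw_void {A : Set ℂ} (hA : MeasurableSet A) {R : ℝ}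
    (hAR : A ⊆ Metric.ball 0 R) (c : ℤ × ℤ) :
    ∑' j, poissonLaw {ω | (j < (ω c).1 ∧ ∀ j', j' < (ω c).1 → j' ≠ j → (ω c).2 j' ∈
        {x | cellPoint c x ∉ A}) ∧
        ∀ c', c' ≠ c → ∀ j', j' < (ω c').1 → (ω c').2 j' ∈ {x | cellPoint c' x ∉ A}}
      = ENNReal.ofReal (Real.exp (-volume.real A)) := by
  have hfin := finite_latticeCell_inter_ball R
  -- The cell `c` is included even if `A` misses it, since its factor carries the exempt point.
  set s : Finset (ℤ × ℤ) := insert c hfin.toFinset with hs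
  have hU : ∀ c', MeasurableSet {x | cellPoint c' x ∉ A} := fun c' =>
    (measurable_cellPoint c' hA).compl
  have hUA : ∀ c', 1 - uniformSquare.real {x | cellPoint c' x ∉ A}
      = uniformSquare.real {x | cellPoint c' x ∈ A} := by
    intro c'
    rw [← probReal_compl_eq_one_sub (hU c')]
    congr 1
    ext x
    simp
  have hzero : ∀ c' ∉ s, uniformSquare {x | cellPoint c' x ∈ A} = 0 := by
    intro c' hc'
    rw [uniformSquare_cellPoint_mem hA]
    have : A ∩ latticeCell c' = ∅ := by
      by_contra hne
      obtain ⟨z, hz⟩ := Set.nonempty_iff_ne_empty.2 hne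
      exact hc' (Finset.mem_insert_of_mem (hfin.mem_toFinset.2 ⟨z, hAR hz.1, hz.2⟩))
    rw [this, measure_empty]
  have hvol : volume.real A = ∑ c' ∈ s, uniformSquare.real {x | cellPoint c' x ∈ A} := by
    rw [measureReal_def, volume_eq_tsum_cellPoint hA, tsum_eq_sum hzero,
      ENNReal.toReal_sum fun c' _ => measure_ne_top _ _]
    rfl
  let V : ℤ × ℤ → Set (ℕ × (ℕ → ℂ)) := fun c' =>
    {ξ | ∀ j', j' < ξ.1 → ξ.2 j' ∈ {x | cellPoint c' x ∉ A}}
  let D : ℕ → Set (ℕ × (ℕ → ℂ)) := fun j =>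
    {ξ | j < ξ.1 ∧ ∀ j', j' < ξ.1 → j' ≠ j → ξ.2 j' ∈ {x | cellPoint c x ∉ A}}
  have hV : ∀ c', cellLaw (V c')
      = ENNReal.ofReal (Real.exp (-uniformSquare.real {x | cellPoint c' x ∈ A})) := fun c' => by
    rw [← hUA]
    exact cellLaw_forall_mem (hU c')
  have hVm : ∀ c', MeasurableSet (V c') := fun c' => by
    have := measurableSet_forall_lt_mem (hU c') fun _ => True
    simp only [forall_const] at this
    exact this
  have hDm : ∀ j, MeasurableSet (D j) := fun j =>
    (measurableSet_lt measurable_const measurable_fst).inter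
      (measurableSet_forall_lt_mem (hU c) fun j' => j' ≠ j)
  have hset : ∀ j, poissonLaw {ω | (j < (ω c).1 ∧ ∀ j', j' < (ω c).1 → j' ≠ j → (ω c).2 j' ∈
        {x | cellPoint c x ∉ A}) ∧
        ∀ c', c' ≠ c → ∀ j', j' < (ω c').1 → (ω c').2 j' ∈ {x | cellPoint c' x ∉ A}}
      = cellLaw (D j) * ∏ c' ∈ s.erase c, cellLaw (V c') := by
    intro j
    have e : {ω : PoissonSpace | (j < (ω c).1 ∧ ∀ j', j' < (ω c).1 → j' ≠ j → (ω c).2 j' ∈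
        {x | cellPoint c x ∉ A}) ∧
        ∀ c', c' ≠ c → ∀ j', j' < (ω c').1 → (ω c').2 j' ∈ {x | cellPoint c' x ∉ A}}
        = Set.univ.pi (Function.update V c (D j)) := by
      ext ω
      constructor
      · rintro ⟨h1, h2⟩ c' -
        rcases eq_or_ne c' c with rfl | hne
        · rw [Function.update_self]
          exact h1
        · rw [Function.update_of_ne hne]
          exact h2 c' hne
      · intro h
        refine ⟨?_, fun c' hne => ?_⟩
        · have := h c trivial
          rwa [Function.update_self] at this
        · have := h c' trivial
          rwa [Function.update_of_ne hne] at this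
    rw [e, poissonLaw_eq, Measure.infinitePi_pi_univ, tprod_eq_prod (s := s),
      ← Finset.mul_prod_erase s _ (Finset.mem_insert_self _ _), Function.update_self]
    · congr 1
      refine Finset.prod_congr rfl fun c' hc' => ?_
      rw [Function.update_of_ne (Finset.ne_of_mem_erase hc')]
    · intro c' hc'
      have hne : c' ≠ c := by
        rintro rfl
        exact hc' (Finset.mem_insert_self _ _)
      rw [Function.update_of_ne hne, hV, measureReal_def, hzero c' hc']
      simp
    · intro c'
      rcases eq_or_ne c' c with rfl | hne
      · rw [Function.update_self]
        exact hDm j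
      · rw [Function.update_of_ne hne]
        exact hVm c'
  have hD : ∑' j, cellLaw (D j)
      = ENNReal.ofReal (Real.exp (-uniformSquare.real {x | cellPoint c x ∈ A})) := by
    rw [← hUA]
    exact tsum_cellLaw_forall_ne_mem (hU c)
  simp_rw [hset]
  rw [ENNReal.tsum_mul_right, hD, ← hV, Finset.mul_prod_erase s (fun c' => cellLaw (V c')) (Finset.mem_insert_self _ _),
    Finset.prod_congr rfl fun c' _ => hV c', ← ENNReal.ofReal_prod_of_nonneg
    fun _ _ => (Real.exp_pos _).le, ← Real.exp_sum, Finset.sum_neg_distrib, ← hvol]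

/-- The event that the `j`-th point of the cell `c` exists, lies in the region `D`, and the region
assigned to it by `A` is free of points. -/
def freeEvent (A : ℂ → Set ℂ) (D : Set ℂ) (c : ℤ × ℤ) (j : ℕ) : Set PoissonSpace :=
  {ω | j < (ω c).1 ∧ cellPoint c ((ω c).2 j) ∈ D ∧
    ∀ c' j', j' < (ω c').1 → cellPoint c' ((ω c').2 j') ∉ A (cellPoint c ((ω c).2 j))}

theorem measurable_point (c : ℤ × ℤ) (j : ℕ) :
    Measurable fun ω : PoissonSpace => cellPoint c ((ω c).2 j) :=
  (measurable_cellPoint c).comp (by fun_prop)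

theorem measurableSet_freeEvent {A : ℂ → Set ℂ} (hA : MeasurableSet {p : ℂ × ℂ | p.2 ∈ A p.1})
    {D : Set ℂ} (hD : MeasurableSet D) (c : ℤ × ℤ) (j : ℕ) :
    MeasurableSet (freeEvent A D c j) := by
  have h1 : ∀ (c : ℤ × ℤ) (j : ℕ), MeasurableSet {ω : PoissonSpace | j < (ω c).1} := fun c j =>
    measurableSet_lt measurable_const (by fun_prop)
  have : freeEvent A D c j = {ω : PoissonSpace | j < (ω c).1} ∩
      ((fun ω : PoissonSpace => cellPoint c ((ω c).2 j)) ⁻¹' D ∩ ⋂ c', ⋂ j',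
      ({ω : PoissonSpace | j' < (ω c').1}ᶜ ∪ ((fun ω : PoissonSpace =>
        (cellPoint c ((ω c).2 j), cellPoint c' ((ω c').2 j'))) ⁻¹' {p : ℂ × ℂ | p.2 ∈ A p.1})ᶜ)) := by
    ext ω
    simp only [freeEvent, Set.mem_ofPred_eq, Set.mem_inter_iff, Set.mem_iInter, Set.mem_union,
      Set.mem_compl_iff, Set.mem_preimage]
    refine and_congr_right fun _ => and_congr_right fun _ => forall₂_congr fun c' j' => ?_
    tauto
  rw [this]
  exact (h1 c j).inter ((measurable_point c j hD).inter (MeasurableSet.iInter fun c' =>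
    MeasurableSet.iInter fun j' => (h1 c' j').compl.union
      (((measurable_point c j).prodMk (measurable_point c' j')) hA).compl))

/-- A case of the Mecke formula. -/
theorem tsum_poissonLaw_freeEvent {A : ℂ → Set ℂ} (hA : MeasurableSet {p : ℂ × ℂ | p.2 ∈ A p.1})
    (hself : ∀ z, z ∉ A z) (hbdd : ∀ z, ∃ R, A z ⊆ Metric.ball 0 R)
    {D : Set ℂ} (hD : MeasurableSet D) :
    ∑' c : ℤ × ℤ, ∑' j : ℕ, poissonLaw (freeEvent A D c j)
      = ∫⁻ z in D, ENNReal.ofReal (Real.exp (-volume.real (A z))) := by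
  rw [← lintegral_indicator hD, lintegral_eq_tsum_cellPoint]
  refine tsum_congr fun c => ?_
  have hE := measurableSet_freeEvent hA hD c
  -- Resampling the `j`-th position makes it a variable `x` independent of the configuration; for
  -- fixed `x` the region `A (cellPoint c x)` is deterministic.
  simp_rw [fun j => poissonLaw_apply_eq_lintegral_resample c j (hE j)]
  rw [← lintegral_tsum fun j => ?_]
  swap
  · exact (measurable_measure_prodMk_right (measurable_resample c j (hE j))).aemeasurable
  refine lintegral_congr fun x => ?_
  have hmem : ∀ j, {ω | resample c j ω x ∈ freeEvent A D c j} =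
      {ω | cellPoint c x ∈ D ∧ (j < (ω c).1 ∧ ∀ j', j' < (ω c).1 → j' ≠ j → (ω c).2 j' ∈
        {y | cellPoint c y ∉ A (cellPoint c x)}) ∧
        ∀ c', c' ≠ c → ∀ j', j' < (ω c').1 →
          (ω c').2 j' ∈ {y | cellPoint c' y ∉ A (cellPoint c x)}} := by
    intro j
    ext ω
    simp only [freeEvent, resample, Set.mem_ofPred_eq, Function.update_self]
    constructor
    · rintro ⟨h1, h2, h3⟩
      refine ⟨h2, ⟨h1, fun j' hj' hne => ?_⟩, fun c' hc' j' hj' => ?_⟩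
      · have := h3 c j'
        simp only [Function.update_self, Function.update_of_ne hne] at this
        exact this hj'
      · have := h3 c' j'
        simp only [Function.update_of_ne hc'] at this
        exact this hj'
    · rintro ⟨h2, ⟨h1, h3⟩, h4⟩
      refine ⟨h1, h2, fun c' j' => ?_⟩
      rcases eq_or_ne c' c with rfl | hc'
      · simp only [Function.update_self]
        rcases eq_or_ne j' j with rfl | hne
        · simp only [Function.update_self]
          exact fun _ => hself _
        · simp only [Function.update_of_ne hne]
          exact fun hj' => h3 j' hj' hne
      · simp only [Function.update_of_ne hc']
        exact fun hj' => h4 c' hc' j' hj'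
  simp_rw [hmem]
  by_cases hx : cellPoint c x ∈ D
  · obtain ⟨R, hR⟩ := hbdd (cellPoint c x)
    rw [Set.indicator_of_mem hx, ← tsum_poissonLaw_void
      (show MeasurableSet (A (cellPoint c x)) from
        measurableSet_preimage (f := fun v : ℂ => (cellPoint c x, v)) (by fun_prop) hA) hR c]
    simp only [hx, true_and]
  · rw [Set.indicator_of_notMem hx]
    simp [hx]

/-- Resampling one of the two positions while the other stays fixed forces the new position onto a
level line, which is null. -/
theorem poissonLaw_height_tie {k : ℕ} (i : Fin k) {c c' : ℤ × ℤ} {j j' : ℕ}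
    (hne : (c, j) ≠ (c', j')) :
    poissonLaw {ω | thetaHeight k i (cellPoint c ((ω c).2 j))
      = thetaHeight k i (cellPoint c' ((ω c').2 j'))} = 0 := by
  have hh := (continuous_thetaHeight k i).measurable
  have hE : MeasurableSet {ω : PoissonSpace | thetaHeight k i (cellPoint c ((ω c).2 j))
      = thetaHeight k i (cellPoint c' ((ω c').2 j'))} :=
    measurableSet_eq_fun (hh.comp (measurable_point c j)) (hh.comp (measurable_point c' j'))
  rw [← map_resample c j, Measure.map_apply (measurable_resample c j) hE,
    Measure.measure_prod_null (measurable_resample c j hE)]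
  refine ae_of_all _ fun ω => ?_
  have hsub : Prod.mk ω ⁻¹' ((fun p : PoissonSpace × ℂ => resample c j p.1 p.2) ⁻¹'
      {ω : PoissonSpace | thetaHeight k i (cellPoint c ((ω c).2 j))
      = thetaHeight k i (cellPoint c' ((ω c').2 j'))}) =
      {x | thetaHeight k i (cellPoint c x) = thetaHeight k i (cellPoint c' ((ω c').2 j'))} := by
    ext x
    simp only [Set.mem_preimage, Set.mem_ofPred_eq, resample, Function.update_self]
    rcases eq_or_ne c' c with rfl | hc
    · have : j' ≠ j := fun h => hne (by rw [h])
      simp [this]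
    · simp [hc]
  simp only [Pi.zero_apply]
  rw [hsub, uniformSquare_eq]
  refine Measure.absolutelyContinuous_of_le Measure.restrict_le_self ?_
  have := volume_thetaHeight_eq k i (thetaHeight k i (cellPoint c' ((ω c').2 j')))
  rwa [← measure_preimage_add volume (((c.1 : ℝ) : ℂ) + ((c.2 : ℝ) : ℂ) * Complex.I)] at this

theorem setOf_thetaMutual_poissonPoints {k : ℕ} (i : Fin k) :
    {ω | ThetaMutual k (insert 0 (poissonPoints ω)) i 0}
      = ⋃ p : (ℤ × ℤ) × ℕ, freeEvent (mutualBlock k 0) (thetaCone k i) p.1 p.2 := by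
  ext ω
  simp only [Set.mem_ofPred_eq, Set.mem_iUnion, thetaMutual_iff, sub_zero]
  have h0 : ∀ w, (0 : ℂ) ∉ mutualBlock k 0 w := fun w =>
    not_or.2 ⟨left_notMem_thetaBlock k 0 w, right_notMem_thetaBlock k w 0⟩
  constructor
  · rintro ⟨-, w, hw, hwc, h⟩
    rcases hw with rfl | ⟨c, j, hj, rfl⟩
    · exact absurd hwc (zero_notMem_thetaCone i)
    · exact ⟨(c, j), hj, hwc, fun c' j' hj' => h _ (Or.inr ⟨c', j', hj', rfl⟩)⟩
  · rintro ⟨⟨c, j⟩, hj, hwc, h⟩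
    refine ⟨Or.inl rfl, _, Or.inr ⟨c, j, hj, rfl⟩, hwc, fun v hv => ?_⟩
    rcases hv with rfl | ⟨c', j', hj', rfl⟩
    · exact h0 _
    · exact h c' j' hj'

/-- The events for different candidate partners are disjoint up to null sets: two partners in one
cone would each have to be no higher than the other. The probability is thus the sum over
candidates, which Mecke's formula evaluates. -/
theorem poissonLaw_thetaMutual {k : ℕ} (hk : 3 ≤ k) (i : Fin k) :
    poissonLaw {ω | ThetaMutual k (insert 0 (poissonPoints ω)) i 0}
      = ∫⁻ z in thetaCone k i, ENNReal.ofReal (Real.exp (-volume.real (mutualBlock k 0 z))) := by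
  have hB := isBlocking_mutualBlock hk
  have hA : MeasurableSet {p : ℂ × ℂ | p.2 ∈ mutualBlock k 0 p.1} :=
    measurableSet_preimage (f := fun p : ℂ × ℂ => ((0 : ℂ), p.1, p.2)) (by fun_prop)
      hB.measurableSet
  have hC := measurableSet_thetaCone i
  rw [setOf_thetaMutual_poissonPoints, measure_iUnion₀]
  · rw [ENNReal.tsum_prod']
    exact tsum_poissonLaw_freeEvent hA (fun z => hB.right_notMem 0 z)
      (fun z => ⟨_, hB.subset_ball 0 z⟩) hC
  · rintro ⟨c, j⟩ ⟨c', j'⟩ hne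
    refine measure_mono_null ?_ (poissonLaw_height_tie i hne)
    rintro ω ⟨⟨h1, h2, h3⟩, h1', h2', h3'⟩
    have a := (not_or.1 (h3 c' j' h1')).1
    have b := (not_or.1 (h3' c j h1)).1
    simp only [Set.mem_ofPred_eq]
    refine le_antisymm ?_ ?_
    · by_contra hlt
      exact a ⟨i, by rwa [sub_zero], by rwa [sub_zero], by
        rw [sub_zero, sub_zero]; exact not_le.1 hlt⟩
    · by_contra hlt
      exact b ⟨i, by rwa [sub_zero], by rwa [sub_zero], by
        rw [sub_zero, sub_zero]; exact not_le.1 hlt⟩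
  · exact fun p => (measurableSet_freeEvent hA hC p.1 p.2).nullMeasurableSet

theorem sum_poissonLaw_thetaMutual {k : ℕ} (hk : 3 ≤ k) :
    ∑ i : Fin k, poissonLaw {ω | ThetaMutual k (insert 0 (poissonPoints ω)) i 0}
      = ∫⁻ z, ENNReal.ofReal (Real.exp (-volume.real (mutualBlock k 0 z))) := by
  rw [← setLIntegral_univ, lintegral_eq_sum_thetaCone (by omega : 0 < k) 0, Measure.restrict_univ]
  refine Finset.sum_congr rfl fun i _ => ?_
  rw [poissonLaw_thetaMutual hk i]
  simp only [sub_zero]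
  rfl

/-! ### Comparing the binomial with the exponential -/

/-- With x = n g, the error is a polynomial in x times exp(-x). Half of the exponent absorbs the
polynomial; the other half is kept so that the bound is still integrable over the plane. -/
theorem abs_mul_one_sub_pow_sub_exp_le {n : ℕ} (hn : 2 ≤ n) {g : ℝ} (h0 : 0 ≤ g) (h1 : g ≤ 1) :
    |((n : ℝ) - 1) * (1 - g) ^ (n - 2) - n * Real.exp (-(n * g))|
      ≤ 15 * Real.exp (-(n / 2 * g)) := by
  have hn' : (2 : ℝ) ≤ n := by exact_mod_cast hn
  set x : ℝ := n * g with hx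
  have hx0 : 0 ≤ x := by positivity
  have hE : Real.exp (-x) = Real.exp (-(n / 2 * g)) * Real.exp (-(x / 2)) := by
    rw [← Real.exp_add]
    congr 1
    rw [hx]
    ring
  have hhalf : Real.exp (x / 2) * Real.exp (-(x / 2)) = 1 := by
    rw [← Real.exp_add, add_neg_cancel, Real.exp_zero]
  have hq := Real.quadratic_le_exp_of_nonneg (by positivity : 0 ≤ x / 2)
  have hp := Real.exp_pos (-(x / 2))
  have hP := Real.exp_pos (-(n / 2 * g))
  have hxexp : x * Real.exp (-(x / 2)) ≤ 1 := by
    rw [← hhalf]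
    refine mul_le_mul_of_nonneg_right ?_ hp.le
    nlinarith [sq_nonneg (x / 2 - 1)]
  have hx2exp : x ^ 2 * Real.exp (-(x / 2)) ≤ 8 := by
    have : x ^ 2 * Real.exp (-(x / 2)) ≤ 8 * (Real.exp (x / 2) * Real.exp (-(x / 2))) := by
      rw [← mul_assoc]
      refine mul_le_mul_of_nonneg_right ?_ hp.le
      nlinarith
    linarith
  have hple : Real.exp (-(x / 2)) ≤ 1 := Real.exp_le_one_iff.2 (by linarith)
  have he2 : Real.exp 2 < 7.5 := by
    have := Real.exp_one_lt_d9
    have e : Real.exp 2 = Real.exp 1 * Real.exp 1 := by rw [← Real.exp_add]; norm_num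
    rw [e]
    nlinarith [Real.exp_pos 1]
  rw [abs_le]
  constructor
  -- Bernoulli's inequality for (1 - g²)^n, where 1 - g² ≤ (1 - g) exp(g).
  · have key : Real.exp (-x) - (1 - g) ^ n ≤ Real.exp (-x) * (n * g ^ 2) := by
      have a1 : 1 - n * g ^ 2 ≤ (1 - g ^ 2) ^ n := by
        have := one_add_mul_le_pow (a := -g ^ 2) (by nlinarith) n
        simpa [sub_eq_add_neg] using this
      have a2 : (1 - g ^ 2) ^ n ≤ ((1 - g) * Real.exp g) ^ n := by
        refine pow_le_pow_left₀ (by nlinarith) ?_ n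
        nlinarith [Real.add_one_le_exp g]
      have a3 : Real.exp (-x) * ((1 - g) * Real.exp g) ^ n = (1 - g) ^ n := by
        rw [mul_pow, ← Real.exp_nat_mul, mul_left_comm, ← Real.exp_add, hx, neg_add_cancel,
          Real.exp_zero, mul_one]
      have := mul_le_mul_of_nonneg_left (a1.trans a2) (Real.exp_pos (-x)).le
      rw [a3] at this
      linarith
    have b1 : (1 - g) ^ n ≤ (1 - g) ^ (n - 2) :=
      pow_le_pow_of_le_one (by linarith) (by linarith) (Nat.sub_le n 2)
    have b2 : (n : ℝ) * Real.exp (-x) - (n - 1) * (1 - g) ^ (n - 2)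
        ≤ Real.exp (-x) + n * (Real.exp (-x) * (n * g ^ 2)) := by
      have c1 : ((n : ℝ) - 1) * (Real.exp (-x) - (1 - g) ^ (n - 2))
          ≤ (n - 1) * (Real.exp (-x) * (n * g ^ 2)) :=
        mul_le_mul_of_nonneg_left (by linarith) (by linarith)
      have c2 : 0 ≤ Real.exp (-x) * (n * g ^ 2) := by positivity
      nlinarith
    have b3 : Real.exp (-x) + n * (Real.exp (-x) * (n * g ^ 2))
        = Real.exp (-(n / 2 * g)) * (Real.exp (-(x / 2)) + x ^ 2 * Real.exp (-(x / 2))) := by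
      rw [hE, hx]
      ring
    rw [b3] at b2
    nlinarith
  -- Here exp(2g) pays for the exponent `n - 2` in place of `n`; as `g ≤ 1`, exp(2g) - 1 ≤ 2g · 7.5,
  -- whence the constant 15.
  · have a1 : (1 - g) ^ (n - 2) ≤ Real.exp (-x) * Real.exp (2 * g) := by
      have := pow_le_pow_left₀ (by linarith) (Real.one_sub_le_exp_neg g) (n - 2)
      rw [← Real.exp_nat_mul, Nat.cast_sub hn] at this
      rw [← Real.exp_add]
      refine this.trans (le_of_eq ?_)
      congr 1
      rw [hx]
      push_cast
      ring
    have a2 : Real.exp (2 * g) - 1 ≤ 2 * g * Real.exp (2 * g) := by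
      have h3 := Real.one_sub_le_exp_neg (2 * g)
      have : Real.exp (2 * g) * Real.exp (-(2 * g)) = 1 := by
        rw [← Real.exp_add, add_neg_cancel, Real.exp_zero]
      nlinarith [Real.exp_pos (2 * g)]
    have a3 : Real.exp (2 * g) ≤ 7.5 :=
      (Real.exp_le_exp.2 (by linarith : 2 * g ≤ 2)).trans he2.le
    have a4 : Real.exp (2 * g) - 1 ≤ 15 * g := by nlinarith
    have b1 : ((n : ℝ) - 1) * (1 - g) ^ (n - 2) ≤ n * (Real.exp (-x) * Real.exp (2 * g)) := by
      have := pow_nonneg (by linarith : 0 ≤ 1 - g) (n - 2)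
      nlinarith
    have b2 : (n : ℝ) * (Real.exp (-x) * Real.exp (2 * g)) - n * Real.exp (-x)
        ≤ n * (Real.exp (-x) * (15 * g)) := by
      rw [← mul_sub, ← mul_sub_one]
      gcongr
    have b3 : (n : ℝ) * (Real.exp (-x) * (15 * g))
        = 15 * (Real.exp (-(n / 2 * g)) * (x * Real.exp (-(x / 2)))) := by
      rw [hE, hx]
      ring
    rw [b3] at b2
    nlinarith

/-! ### The Poisson integral of a blocking family -/

namespace IsBlocking

variable {k : ℕ} {B : ℂ → ℂ → Set ℂ}

theorem measurable_volume_inter (hB : IsBlocking k B) {R : Set ℂ} (hR : MeasurableSet R) :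
    Measurable fun p : ℂ × ℂ => volume.real (B p.1 p.2 ∩ R) := by
  have h : MeasurableSet {q : (ℂ × ℂ) × ℂ | q.2 ∈ B q.1.1 q.1.2 ∩ R} :=
    (measurableSet_preimage (f := fun q : (ℂ × ℂ) × ℂ => (q.1.1, q.1.2, q.2)) (by fun_prop)
      hB.measurableSet).inter (measurableSet_preimage measurable_snd hR)
  exact (measurable_measure_prodMk_left h).ennreal_toReal

theorem measurable_volume_inter_right (hB : IsBlocking k B) {R : Set ℂ} (hR : MeasurableSet R)
    (u : ℂ) : Measurable fun w => volume.real (B u w ∩ R) := by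
  have h : MeasurableSet {q : ℂ × ℂ | q.2 ∈ B u q.1 ∩ R} :=
    (measurableSet_preimage (f := fun q : ℂ × ℂ => (u, q.1, q.2)) (by fun_prop)
      hB.measurableSet).inter (measurableSet_preimage measurable_snd hR)
  exact (measurable_measure_prodMk_left h).ennreal_toReal

theorem measurable_volume (hB : IsBlocking k B) (u : ℂ) :
    Measurable fun w => volume.real (B u w) := by
  simpa using hB.measurable_volume_inter_right MeasurableSet.univ u

theorem volumeReal_add_right (hB : IsBlocking k B) (u w : ℂ) :
    volume.real (B u (u + w)) = volume.real (B 0 w) := by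
  have := hB.volume_add_right 0 w u
  rw [zero_add, add_comm w u] at this
  rw [measureReal_def, this, measureReal_def]

theorem lintegral_exp_neg_le (hB : IsBlocking k B) (hk : 3 ≤ k) :
    ∫⁻ w, ENNReal.ofReal (Real.exp (-volume.real (B 0 w))) ≤ k := by
  rw [← lintegral_exp_neg_thetaBlock hk]
  refine lintegral_mono fun w => ENNReal.ofReal_le_ofReal (Real.exp_le_exp.2 (neg_le_neg ?_))
  exact measureReal_mono (hB.block_subset 0 w) (hB.volume_lt_top 0 w).ne

theorem integrable_exp_neg (hB : IsBlocking k B) (hk : 3 ≤ k) :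
    Integrable fun w => Real.exp (-volume.real (B 0 w)) := by
  have hm : Measurable fun w => Real.exp (-volume.real (B 0 w)) := (hB.measurable_volume 0).neg.exp
  refine ⟨hm.aestronglyMeasurable, ?_⟩
  rw [hasFiniteIntegral_iff_ofReal (ae_of_all _ fun w => (Real.exp_pos _).le)]
  exact (hB.lintegral_exp_neg_le hk).trans_lt (ENNReal.natCast_lt_top k)

end IsBlocking

/-- The integral that describes how many points `w` of a Poisson process see their region `B 0 w`
free of points. -/
noncomputable def freeIntegral (B : ℂ → ℂ → Set ℂ) : ℝ :=
  ∫ w, Real.exp (-volume.real (B 0 w))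

theorem freeIntegral_nonneg (B : ℂ → ℂ → Set ℂ) : 0 ≤ freeIntegral B :=
  integral_nonneg fun _ => (Real.exp_pos _).le

theorem ofReal_freeIntegral {k : ℕ} {B : ℂ → ℂ → Set ℂ} (hB : IsBlocking k B) (hk : 3 ≤ k) :
    ENNReal.ofReal (freeIntegral B)
      = ∫⁻ w, ENNReal.ofReal (Real.exp (-volume.real (B 0 w))) :=
  ofReal_integral_eq_lintegral_ofReal (hB.integrable_exp_neg hk)
    (ae_of_all _ fun _ => (Real.exp_pos _).le)

theorem freeIntegral_le {k : ℕ} {B : ℂ → ℂ → Set ℂ} (hB : IsBlocking k B) (hk : 3 ≤ k) :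
    freeIntegral B ≤ k := by
  rw [← ENNReal.ofReal_le_ofReal_iff (Nat.cast_nonneg k), ofReal_freeIntegral hB hk,
    ENNReal.ofReal_natCast]
  exact hB.lintegral_exp_neg_le hk

theorem freeIntegral_thetaBlock {k : ℕ} (hk : 3 ≤ k) : freeIntegral (thetaBlock k) = k := by
  have := ofReal_freeIntegral (isBlocking_thetaBlock hk) hk
  rw [lintegral_exp_neg_thetaBlock hk, ← ENNReal.ofReal_natCast] at this
  exact (ENNReal.ofReal_eq_ofReal_iff (freeIntegral_nonneg _) (Nat.cast_nonneg k)).1 this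

theorem avgDegree_eq {k : ℕ} (hk : 3 ≤ k) : avgDegree k = 2 * k - freeIntegral (mutualBlock k) := by
  have hk0 : (k : ℝ) ≠ 0 := by positivity
  have h : ∑ i : Fin k, poissonLaw.real {ω | ThetaMutual k (insert 0 (poissonPoints ω)) i 0}
      = freeIntegral (mutualBlock k) := by
    have := sum_poissonLaw_thetaMutual hk
    rw [← ofReal_freeIntegral (isBlocking_mutualBlock hk) hk] at this
    have h2 := congrArg ENNReal.toReal this
    rw [ENNReal.toReal_ofReal (freeIntegral_nonneg _),
      ENNReal.toReal_sum fun i _ => measure_ne_top _ _] at h2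
    exact h2
  rw [avgDegree, mutualProb, h, sub_mul, div_mul_cancel₀ _ hk0]

/-- Areas are homogeneous of degree 2, so intensity `a` amounts to a dilation by `√a`. -/
theorem exp_neg_mul_volume_eq {k : ℕ} {B : ℂ → ℂ → Set ℂ} (hB : IsBlocking k B) {a : ℝ}
    (ha : 0 < a) (w : ℂ) : Real.exp (-(a * volume.real (B 0 w)))
      = Real.exp (-volume.real (B 0 (Real.sqrt a • w))) := by
  rw [measureReal_def, measureReal_def, Complex.real_smul, hB.volume_mul (Real.sqrt_pos.2 ha),
    ENNReal.toReal_mul, ENNReal.toReal_ofReal (by positivity), Real.sq_sqrt ha.le]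

theorem integrable_exp_neg_mul_volume {k : ℕ} {B : ℂ → ℂ → Set ℂ} (hB : IsBlocking k B)
    (hk : 3 ≤ k) {a : ℝ} (ha : 0 < a) :
    Integrable fun w => Real.exp (-(a * volume.real (B 0 w))) := by
  simp_rw [exp_neg_mul_volume_eq hB ha]
  exact (hB.integrable_exp_neg hk).comp_smul (Real.sqrt_pos.2 ha).ne'

theorem integral_exp_neg_mul_volume {k : ℕ} {B : ℂ → ℂ → Set ℂ} (hB : IsBlocking k B) {a : ℝ}
    (ha : 0 < a) : ∫ w, Real.exp (-(a * volume.real (B 0 w))) = freeIntegral B / a := by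
  simp_rw [exp_neg_mul_volume_eq hB ha]
  rw [Measure.integral_comp_smul (μ := volume) (fun w => Real.exp (-volume.real (B 0 w))),
    Complex.finrank_real_complex, Real.sq_sqrt ha.le, abs_of_nonneg (by positivity), smul_eq_mul,
    freeIntegral]
  ring

/-! ### Uniform points in the square -/

/-- The conditional probability that `n - 2` uniform points of the unit square avoid the region
`B u w`. -/
noncomputable def avoidProb (n : ℕ) (B : ℂ → ℂ → Set ℂ) (u w : ℂ) : ℝ :=
  (1 - volume.real (B u w ∩ unitSquare)) ^ (n - 2)

theorem volumeReal_inter_unitSquare_le (A : Set ℂ) : volume.real (A ∩ unitSquare) ≤ 1 := by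
  have h : volume.real unitSquare = 1 := by
    rw [measureReal_def, volume_unitSquare, ENNReal.toReal_one]
  rw [← h]
  exact measureReal_mono Set.inter_subset_right (by simp [volume_unitSquare])

theorem avoidProb_nonneg (n : ℕ) (B : ℂ → ℂ → Set ℂ) (u w : ℂ) : 0 ≤ avoidProb n B u w :=
  pow_nonneg (sub_nonneg.2 (volumeReal_inter_unitSquare_le _)) _

theorem avoidProb_le_one (n : ℕ) (B : ℂ → ℂ → Set ℂ) (u w : ℂ) : avoidProb n B u w ≤ 1 :=
  pow_le_one₀ (sub_nonneg.2 (volumeReal_inter_unitSquare_le _))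
    (sub_le_self _ measureReal_nonneg)

theorem avoidProb_le_exp {n : ℕ} (hn : 2 ≤ n) (B : ℂ → ℂ → Set ℂ) (u w : ℂ) :
    avoidProb n B u w ≤ Real.exp (-((n - 2) * volume.real (B u w ∩ unitSquare))) := by
  have := pow_le_pow_left₀ (sub_nonneg.2 (volumeReal_inter_unitSquare_le (B u w)))
    (Real.one_sub_le_exp_neg (volume.real (B u w ∩ unitSquare))) (n - 2)
  rw [← Real.exp_nat_mul, Nat.cast_sub hn] at this
  refine this.trans (le_of_eq ?_)
  congr 1
  push_cast
  ring

theorem measurable_avoidProb {k : ℕ} {B : ℂ → ℂ → Set ℂ} (hB : IsBlocking k B) (n : ℕ) :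
    Measurable fun p : ℂ × ℂ => avoidProb n B p.1 p.2 :=
  ((hB.measurable_volume_inter measurableSet_unitSquare).const_sub 1).pow_const _

theorem measurable_avoidProb_right {k : ℕ} {B : ℂ → ℂ → Set ℂ} (hB : IsBlocking k B) (n : ℕ)
    (u : ℂ) : Measurable (avoidProb n B u) :=
  ((hB.measurable_volume_inter_right measurableSet_unitSquare u).const_sub 1).pow_const _

theorem integrable_of_abs_le {α : Type*} [MeasurableSpace α] {μ : Measure α} [IsFiniteMeasure μ]
    {f : α → ℝ} (hf : AEStronglyMeasurable f μ) {C : ℝ} (h : ∀ a, |f a| ≤ C) : Integrable f μ :=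
  Integrable.of_bound hf C (ae_of_all _ h)

theorem integrable_avoidProb {k : ℕ} {B : ℂ → ℂ → Set ℂ} (hB : IsBlocking k B) (n : ℕ)
    (u : ℂ) : Integrable (avoidProb n B u) uniformSquare := by
  refine integrable_of_abs_le (C := 1) (measurable_avoidProb_right hB n u).aestronglyMeasurable
    fun w => ?_
  rw [abs_of_nonneg (avoidProb_nonneg _ _ _ _)]
  exact avoidProb_le_one _ _ _ _

/-- The expected number of uniform points `w` of the unit square whose region `B u w` is free of
the other points. -/
noncomputable def freeCount (n : ℕ) (B : ℂ → ℂ → Set ℂ) (u : ℂ) : ℝ :=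
  (n - 1) * ∫ w, avoidProb n B u w ∂uniformSquare

theorem freeCount_nonneg {n : ℕ} (hn : 2 ≤ n) (B : ℂ → ℂ → Set ℂ) (u : ℂ) :
    0 ≤ freeCount n B u := by
  have hn' : (2 : ℝ) ≤ n := by exact_mod_cast hn
  exact mul_nonneg (by linarith) (integral_nonneg fun w => avoidProb_nonneg _ _ _ _)

/-- A bound without boundary terms: `B` contains `thetaBlock`, and the rank estimate applies to
`thetaBlock` cut by the square. -/
theorem freeCount_le {k n : ℕ} (hk : 3 ≤ k) (hn : 2 ≤ n) {B : ℂ → ℂ → Set ℂ}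
    (hB : IsBlocking k B) (u : ℂ) : freeCount n B u ≤ 3 * k := by
  have hn' : (2 : ℝ) ≤ n := by exact_mod_cast hn
  have hc : (0 : ℝ) < n - 1 := by linarith
  have hfin : volume unitSquare < ⊤ := by simp [volume_unitSquare]
  have hTm := (isBlocking_thetaBlock hk).measurable_volume_inter_right measurableSet_unitSquare u
  have hm : Measurable fun w =>
      Real.exp (-((n - 1) * volume.real (thetaBlock k u w ∩ unitSquare))) :=
    (hTm.const_mul _).neg.exp
  have hint : Integrable (fun w =>
      Real.exp (-((n - 1) * volume.real (thetaBlock k u w ∩ unitSquare)))) uniformSquare := by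
    refine integrable_of_abs_le (C := 1) hm.aestronglyMeasurable fun w => ?_
    rw [abs_of_nonneg (Real.exp_pos _).le, Real.exp_le_one_iff]
    exact neg_nonpos.2 (mul_nonneg hc.le measureReal_nonneg)
  have h1 : ∫ w, Real.exp (-((n - 1) * volume.real (thetaBlock k u w ∩ unitSquare))) ∂uniformSquare
      ≤ k / (n - 1) := by
    rw [← ENNReal.ofReal_le_ofReal_iff (by positivity), ofReal_integral_eq_lintegral_ofReal hint
      (ae_of_all _ fun _ => (Real.exp_pos _).le), uniformSquare_eq]
    exact lintegral_exp_neg_thetaBlock_le (by omega) u hfin hc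
  have h2 : ∫ w, avoidProb n B u w ∂uniformSquare
      ≤ ∫ w, 3 * Real.exp (-((n - 1) * volume.real (thetaBlock k u w ∩ unitSquare)))
        ∂uniformSquare := by
    refine integral_mono (integrable_avoidProb hB n u) (hint.const_mul 3) fun w => ?_
    refine (avoidProb_le_exp hn B u w).trans ?_
    have hle : volume.real (thetaBlock k u w ∩ unitSquare) ≤ volume.real (B u w ∩ unitSquare) :=
      measureReal_mono (Set.inter_subset_inter_left _ (hB.block_subset u w))
        ((measure_mono Set.inter_subset_right).trans_lt hfin).ne
    have hle1 := volumeReal_inter_unitSquare_le (thetaBlock k u w)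
    -- The factor 3 ≥ e pays for passing from `n - 2` to `n - 1` in the exponent, as the area is at
    -- most 1.
    have he : Real.exp 1 ≤ 3 := by linarith [Real.exp_one_lt_d9]
    refine le_trans ?_ (mul_le_mul_of_nonneg_right he (Real.exp_pos _).le)
    rw [← Real.exp_add]
    refine Real.exp_le_exp.2 ?_
    nlinarith
  rw [integral_const_mul] at h2
  calc freeCount n B u ≤ (n - 1) * (3 * (k / (n - 1))) :=
        mul_le_mul_of_nonneg_left (by linarith) hc.le
    _ = 3 * k := by field_simp

/-! ### The cutoff and the error estimate -/

/-- The scale at which boundary effects are cut off. -/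
noncomputable def cutoff (k n : ℕ) : ℝ := Real.sqrt (2 * k * Real.log n / n)

theorem cutoff_sq (k n : ℕ) : cutoff k n ^ 2 = 2 * k * Real.log n / n :=
  Real.sq_sqrt (by have := Real.log_natCast_nonneg n; positivity)

theorem inv_sqrt_le_cutoff {k n : ℕ} (hk : 3 ≤ k) (hn : 2 ≤ n) : 1 / Real.sqrt n ≤ cutoff k n := by
  have hn' : (2 : ℝ) ≤ n := by exact_mod_cast hn
  have hk' : (3 : ℝ) ≤ k := by exact_mod_cast hk
  have hlog : Real.log 2 ≤ Real.log n := Real.log_le_log (by norm_num) hn'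
  have := Real.log_two_gt_d9
  rw [cutoff, ← Real.sqrt_one, ← Real.sqrt_div zero_le_one]
  refine Real.sqrt_le_sqrt ?_
  gcongr
  nlinarith

theorem cutoff_pos {k n : ℕ} (hk : 3 ≤ k) (hn : 2 ≤ n) : 0 < cutoff k n := by
  have hn' : (0 : ℝ) < n := by positivity
  exact lt_of_lt_of_le (by positivity) (inv_sqrt_le_cutoff hk hn)

/-- The right side equals (π/2) log n, so avoiding a sector of radius half the cutoff costs a factor
of n^(-3/2). -/
theorem log_le_cutoff_area {k n : ℕ} (hk : 3 ≤ k) (hn : 2 ≤ n) :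
    3 / 2 * Real.log n ≤ n * (Real.pi * (cutoff k n / 2) ^ 2 / k) := by
  have hn' : (0 : ℝ) < n := by positivity
  have hk' : (0 : ℝ) < k := by positivity
  have e : n * (Real.pi * (cutoff k n / 2) ^ 2 / k) = Real.pi / 2 * Real.log n := by
    rw [div_pow, cutoff_sq]
    field_simp
  rw [e]
  have := Real.log_natCast_nonneg n
  have := Real.pi_gt_three
  nlinarith

theorem exp_neg_log_half {n : ℕ} (hn : 2 ≤ n) :
    Real.exp (-(Real.log n / 2)) = 1 / Real.sqrt n := by
  have hn' : (0 : ℝ) < n := by positivity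
  rw [Real.exp_neg, ← Real.log_sqrt hn'.le, Real.exp_log (Real.sqrt_pos.2 hn'), one_div]

/-- For `‖w‖` up to the cutoff, the region lies in the ball `hu` and is not truncated, so the
binomial comparison applies. Beyond it, the difference is bounded by the sum of two small terms: the
binomial one on the square only, the exponential one by an integrable function. -/
theorem pointwise_error {k n : ℕ} (hk : 3 ≤ k) (hn : 2 ≤ n) {B : ℂ → ℂ → Set ℂ}
    (hB : IsBlocking k B) {u : ℂ} (hu : Metric.ball u (3 * cutoff k n) ⊆ unitSquare) (w : ℂ) :
    |unitSquare.indicator (fun v => (n - 1) * avoidProb n B u v) (u + w)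
        - n * Real.exp (-(n * volume.real (B 0 w)))|
      ≤ (15 + Real.sqrt n) * Real.exp (-(n / 2 * volume.real (B 0 w)))
        + unitSquare.indicator (fun _ => 8 / Real.sqrt n) (u + w) := by
  have hn' : (2 : ℝ) ≤ n := by exact_mod_cast hn
  have hr := cutoff_pos hk hn
  have hs : 0 < Real.sqrt n := Real.sqrt_pos.2 (by linarith)
  have hss : Real.sqrt n * Real.sqrt n = n := Real.mul_self_sqrt (by linarith)
  set g := volume.real (B 0 w) with hg
  have hg0 : 0 ≤ g := measureReal_nonneg
  have hP := Real.exp_pos (-(n / 2 * g))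
  have hfin : volume unitSquare < ⊤ := by simp [volume_unitSquare]
  rcases le_or_gt ‖w‖ (cutoff k n) with hw | hw
  · have hmem : u + w ∈ unitSquare := by
      refine hu ?_
      rw [Metric.mem_ball, dist_eq_norm, add_sub_cancel_left]
      linarith
    have hsub : B u (u + w) ⊆ unitSquare := by
      refine (hB.subset_ball u (u + w)).trans ((Metric.ball_subset_ball ?_).trans hu)
      rw [add_sub_cancel_left]
      linarith
    have hvol : volume.real (B u (u + w) ∩ unitSquare) = g := by
      rw [Set.inter_eq_left.2 hsub, hB.volumeReal_add_right]
    have hg1 : g ≤ 1 := hvol ▸ volumeReal_inter_unitSquare_le _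
    rw [Set.indicator_of_mem hmem, Set.indicator_of_mem hmem, avoidProb, hvol]
    refine (abs_mul_one_sub_pow_sub_exp_le hn hg0 hg1).trans ?_
    have : 0 ≤ 8 / Real.sqrt n := by positivity
    have : 0 ≤ Real.sqrt n * Real.exp (-(n / 2 * g)) := by positivity
    linarith
  · set q := Real.pi * (cutoff k n / 2) ^ 2 / k with hq
    have hq0 : 0 ≤ q := by
      have := Real.pi_pos
      positivity
    have hlog := log_le_cutoff_area hk hn
    have hlog0 := Real.log_natCast_nonneg n
    have hqle : ∀ v, cutoff k n ≤ ‖v - u‖ →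
        q ≤ volume.real (B u v ∩ Metric.ball u (cutoff k n)) := by
      intro v hv
      have h1 := (le_volume_thetaBlock_inter hk hr hv).trans
        (measure_mono (Set.inter_subset_inter_left _ (hB.block_subset u v)))
      exact (ENNReal.ofReal_le_iff_le_toReal
        ((measure_mono Set.inter_subset_right).trans_lt measure_ball_lt_top).ne).1 h1
    have hw' : cutoff k n ≤ ‖u + w - u‖ := by
      rw [add_sub_cancel_left]
      exact hw.le
    have hqg : q ≤ g := by
      rw [hg, ← hB.volumeReal_add_right u w]
      exact (hqle _ hw').trans (measureReal_mono Set.inter_subset_left (hB.volume_lt_top _ _).ne)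
    have hqb : q ≤ volume.real (B u (u + w) ∩ unitSquare) := by
      refine (hqle _ hw').trans (measureReal_mono (Set.inter_subset_inter_right _
        ((Metric.ball_subset_ball (by linarith)).trans hu))
        ((measure_mono Set.inter_subset_right).trans_lt hfin).ne)
    have hF : (n - 1) * avoidProb n B u (u + w) ≤ 8 / Real.sqrt n := by
      have hb1 := volumeReal_inter_unitSquare_le (B u (u + w))
      -- The 3/2 log n of `log_le_cutoff_area` gives n^(-3/2); exp 2 accounts for the exponent `n -
      -- 2`.
      have h1 : avoidProb n B u (u + w) ≤ Real.exp 2 * (1 / Real.sqrt n * (1 / n)) := by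
        have e : (1 : ℝ) / n = Real.exp (-Real.log n) := by
          rw [Real.exp_neg, Real.exp_log (by linarith), one_div]
        refine (avoidProb_le_exp hn B u (u + w)).trans ?_
        rw [e, ← exp_neg_log_half hn, ← Real.exp_add, ← Real.exp_add]
        refine Real.exp_le_exp.2 ?_
        have := mul_le_mul_of_nonneg_left hqb (by linarith : (0 : ℝ) ≤ n)
        nlinarith
      have he2 : Real.exp 2 ≤ 8 := by
        have := Real.exp_one_lt_d9
        have e : Real.exp 2 = Real.exp 1 * Real.exp 1 := by rw [← Real.exp_add]; norm_num
        rw [e]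
        nlinarith [Real.exp_pos 1]
      calc (n - 1) * avoidProb n B u (u + w) ≤ n * (8 * (1 / Real.sqrt n * (1 / n))) := by
            refine mul_le_mul (by linarith) (h1.trans ?_) (avoidProb_nonneg _ _ _ _) (by linarith)
            gcongr
        _ = 8 / Real.sqrt n := by field_simp
    -- One half of the exponent is spent on the gain 1/√n, the other half is kept for integrability.
    have hE : n * Real.exp (-(n * g)) ≤ Real.sqrt n * Real.exp (-(n / 2 * g)) := by
      have e : Real.exp (-(n * g)) = Real.exp (-(n / 2 * g)) * Real.exp (-(n / 2 * g)) := by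
        rw [← Real.exp_add]
        congr 1
        ring
      have h1 : Real.exp (-(n / 2 * g)) ≤ 1 / Real.sqrt n := by
        rw [← exp_neg_log_half hn]
        refine Real.exp_le_exp.2 ?_
        have := mul_le_mul_of_nonneg_left hqg (by linarith : (0 : ℝ) ≤ n)
        linarith
      calc n * Real.exp (-(n * g)) ≤ n * (Real.exp (-(n / 2 * g)) * (1 / Real.sqrt n)) := by
            rw [e]
            gcongr
        _ = Real.sqrt n * Real.exp (-(n / 2 * g)) := by
            rw [← hss]
            field_simp
            rw [Real.sqrt_sq hs.le]
    have hE0 : 0 ≤ n * Real.exp (-(n * g)) := by positivity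
    by_cases hmem : u + w ∈ unitSquare
    · rw [Set.indicator_of_mem hmem, Set.indicator_of_mem hmem]
      have hF0 : 0 ≤ (n - 1) * avoidProb n B u (u + w) :=
        mul_nonneg (by linarith) (avoidProb_nonneg _ _ _ _)
      rw [abs_le]
      constructor <;> linarith
    · rw [Set.indicator_of_notMem hmem, Set.indicator_of_notMem hmem, zero_sub, abs_neg,
        abs_of_nonneg hE0]
      linarith

theorem abs_freeCount_sub_le_of_interior {k n : ℕ} (hk : 3 ≤ k) (hn : 2 ≤ n) {B : ℂ → ℂ → Set ℂ}
    (hB : IsBlocking k B) {u : ℂ} (hu : Metric.ball u (3 * cutoff k n) ⊆ unitSquare) :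
    |freeCount n B u - freeIntegral B| ≤ 40 * k * cutoff k n := by
  have hn' : (2 : ℝ) ≤ n := by exact_mod_cast hn
  have hk' : (3 : ℝ) ≤ k := by exact_mod_cast hk
  have hn0 : (0 : ℝ) < n := by linarith
  have hs : 0 < Real.sqrt n := Real.sqrt_pos.2 (by linarith)
  have hss : Real.sqrt n * Real.sqrt n = n := Real.mul_self_sqrt (by linarith)
  have hshift : ∀ f : ℂ → ℝ, ∫ w, unitSquare.indicator f (u + w) = ∫ w, f w ∂uniformSquare := by
    intro f
    rw [integral_add_left_eq_self (fun w => unitSquare.indicator f w) u,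
      integral_indicator measurableSet_unitSquare, uniformSquare_eq]
  have hshiftInt : ∀ f : ℂ → ℝ, Integrable f uniformSquare →
      Integrable fun w => unitSquare.indicator f (u + w) := by
    intro f hf
    rw [uniformSquare_eq] at hf
    exact ((integrable_indicator_iff measurableSet_unitSquare).2 hf).comp_add_left u
  have hF := hshiftInt _ ((integrable_avoidProb hB n u).const_mul ((n : ℝ) - 1))
  have hE := (integrable_exp_neg_mul_volume hB hk hn0).const_mul (n : ℝ)
  have hH := (integrable_exp_neg_mul_volume hB hk (half_pos hn0)).const_mul (15 + Real.sqrt n)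
  have hc := hshiftInt _ (integrable_const (8 / Real.sqrt n))
  have e1 : freeCount n B u - freeIntegral B
      = ∫ w, (unitSquare.indicator (fun v => (n - 1) * avoidProb n B u v) (u + w)
        - n * Real.exp (-(n * volume.real (B 0 w)))) := by
    rw [integral_sub hF hE, hshift, integral_const_mul, integral_const_mul,
      integral_exp_neg_mul_volume hB hn0, mul_div_cancel₀ _ hn0.ne', freeCount]
  rw [e1, ← Real.norm_eq_abs]
  refine (norm_integral_le_of_norm_le (hH.add hc)
    (ae_of_all _ fun w => pointwise_error hk hn hB hu w)).trans ?_
  simp only [Pi.add_apply]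
  rw [integral_add hH hc, hshift, integral_const_mul, integral_exp_neg_mul_volume hB (half_pos hn0)]
  simp only [integral_const, probReal_univ, one_smul]
  have hI := freeIntegral_le hB hk
  have hI0 := freeIntegral_nonneg B
  have hs1 : 1 ≤ Real.sqrt n := Real.one_le_sqrt.2 (by linarith)
  -- From 15 + √n ≤ 16 √n, and a factor 2 since the intensity is `n / 2`.
  have h1 : (15 + Real.sqrt n) * (freeIntegral B / (n / 2)) ≤ 32 * k * (1 / Real.sqrt n) := by
    have : (15 + Real.sqrt n) * (freeIntegral B / (n / 2)) ≤ (16 * Real.sqrt n) * (k / (n / 2)) := by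
      gcongr
      linarith
    refine this.trans (le_of_eq ?_)
    rw [← hss]
    field_simp
    rw [Real.sqrt_sq hs.le]
    ring
  have h2 : 8 / Real.sqrt n ≤ 8 * k * (1 / Real.sqrt n) := by
    rw [div_eq_mul_one_div]
    gcongr
    linarith
  calc _ ≤ 40 * k * (1 / Real.sqrt n) := by linarith
    _ ≤ 40 * k * cutoff k n := by
      gcongr
      exact inv_sqrt_le_cutoff hk hn

theorem measurable_freeCount {k n : ℕ} {B : ℂ → ℂ → Set ℂ} (hB : IsBlocking k B) :
    Measurable (freeCount n B) := by
  have := (measurable_avoidProb hB n).stronglyMeasurable.integral_prod_right' (ν := uniformSquare)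
  exact this.measurable.const_mul _

theorem volumeReal_boundary_le {ε : ℝ} (h0 : 0 ≤ ε) (h1 : ε ≤ 1 / 2) :
    uniformSquare.real {z | z.re ∈ Set.Icc ε (1 - ε) ∧ z.im ∈ Set.Icc ε (1 - ε)}ᶜ ≤ 4 * ε := by
  have hm : MeasurableSet {z : ℂ | z.re ∈ Set.Icc ε (1 - ε) ∧ z.im ∈ Set.Icc ε (1 - ε)} :=
    (measurableSet_preimage Complex.measurable_re measurableSet_Icc).inter
      (measurableSet_preimage Complex.measurable_im measurableSet_Icc)
  have h : {z : ℂ | z.re ∈ Set.Icc ε (1 - ε) ∧ z.im ∈ Set.Icc ε (1 - ε)}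
      = Complex.measurableEquivRealProd ⁻¹' (Set.Icc ε (1 - ε) ×ˢ Set.Icc ε (1 - ε)) := by
    ext z
    simp [Complex.measurableEquivRealProd_apply]
    tauto
  have hsub : {z : ℂ | z.re ∈ Set.Icc ε (1 - ε) ∧ z.im ∈ Set.Icc ε (1 - ε)} ⊆ unitSquare :=
    fun z hz => ⟨⟨h0.trans hz.1.1, by linarith [hz.1.2]⟩, ⟨h0.trans hz.2.1, by linarith [hz.2.2]⟩⟩
  rw [probReal_compl_eq_one_sub hm, measureReal_def, uniformSquare_eq, Measure.restrict_apply hm,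
    Set.inter_eq_left.2 hsub, h, Complex.volume_preserving_equiv_real_prod.measure_preimage_equiv,
    Measure.volume_eq_prod, Measure.prod_prod, Real.volume_Icc, ENNReal.toReal_mul,
    ENNReal.toReal_ofReal (by linarith)]
  nlinarith

theorem abs_integral_freeCount_sub_le {k n : ℕ} (hk : 3 ≤ k) (hn : 2 ≤ n) {B : ℂ → ℂ → Set ℂ}
    (hB : IsBlocking k B) :
    |∫ u, freeCount n B u ∂uniformSquare - freeIntegral B| ≤ 100 * k * cutoff k n := by
  have hk' : (3 : ℝ) ≤ k := by exact_mod_cast hk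
  have hr := cutoff_pos hk hn
  have hbd : ∀ u, |freeCount n B u - freeIntegral B| ≤ 3 * k := by
    intro u
    have h1 := freeCount_nonneg hn B u
    have h2 := freeCount_le hk hn hB u
    have h3 := freeIntegral_nonneg B
    have h4 := freeIntegral_le hB hk
    rw [abs_le]
    constructor <;> linarith
  have hint : Integrable (freeCount n B) uniformSquare := by
    refine integrable_of_abs_le (C := 3 * k) (measurable_freeCount hB).aestronglyMeasurable
      fun u => ?_
    rw [abs_of_nonneg (freeCount_nonneg hn B u)]
    exact freeCount_le hk hn hB u
  have e : ∫ u, freeCount n B u ∂uniformSquare - freeIntegral B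
      = ∫ u, (freeCount n B u - freeIntegral B) ∂uniformSquare := by
    rw [integral_sub hint (integrable_const _)]
    simp
  rw [e, ← Real.norm_eq_abs]
  rcases le_or_gt (cutoff k n) (1 / 6) with h6 | h6
  · set S : Set ℂ := {z | z.re ∈ Set.Icc (3 * cutoff k n) (1 - 3 * cutoff k n) ∧
      z.im ∈ Set.Icc (3 * cutoff k n) (1 - 3 * cutoff k n)} with hS
    have hm : MeasurableSet S :=
      (measurableSet_preimage Complex.measurable_re measurableSet_Icc).inter
        (measurableSet_preimage Complex.measurable_im measurableSet_Icc)
    have hball : ∀ u ∈ S, Metric.ball u (3 * cutoff k n) ⊆ unitSquare := by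
      intro u hu v hv
      rw [Metric.mem_ball, dist_eq_norm] at hv
      have h1 := abs_le.1 ((Complex.abs_re_le_norm (v - u)).trans hv.le)
      have h2 := abs_le.1 ((Complex.abs_im_le_norm (v - u)).trans hv.le)
      rw [Complex.sub_re] at h1
      rw [Complex.sub_im] at h2
      obtain ⟨⟨a, b⟩, c, d⟩ := hu
      exact ⟨⟨by linarith, by linarith⟩, ⟨by linarith, by linarith⟩⟩
    have hind : Integrable (Sᶜ.indicator fun _ => 3 * (k : ℝ)) uniformSquare :=
      (integrable_const _).indicator hm.compl
    refine (norm_integral_le_of_norm_le ((integrable_const (40 * k * cutoff k n)).add hind)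
      (ae_of_all _ fun u => ?_)).trans ?_
    · rw [Real.norm_eq_abs, Pi.add_apply]
      by_cases hu : u ∈ S
      · rw [Set.indicator_of_notMem (Set.notMem_compl_iff.2 hu), add_zero]
        exact abs_freeCount_sub_le_of_interior hk hn hB (hball u hu)
      · rw [Set.indicator_of_mem hu]
        refine (hbd u).trans (le_add_of_nonneg_left (by positivity))
    · simp only [Pi.add_apply]
      rw [integral_add (integrable_const _) hind, integral_indicator hm.compl, setIntegral_const]
      simp only [integral_const, probReal_univ, smul_eq_mul]
      -- The strip has measure at most 12 times the cutoff, and the error there is at most 3k: this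
      -- adds 36 to the 40 of the interior.
      have := volumeReal_boundary_le (ε := 3 * cutoff k n) (by positivity) (by linarith)
      have h3 : uniformSquare.real Sᶜ * (3 * k) ≤ 4 * (3 * cutoff k n) * (3 * k) := by gcongr
      nlinarith
  -- If the cutoff exceeds 1/6, the interior may be empty, but the crude bound 3k suffices.
  · refine (norm_integral_le_of_norm_le (integrable_const (3 * (k : ℝ)))
      (ae_of_all _ fun u => hbd u)).trans ?_
    simp only [integral_const, probReal_univ, one_smul]
    nlinarith

/-! ### Counting the edges -/

theorem thetaGraph_range_adj_iff {k n : ℕ} (hk : 0 < k) {x : Fin n → ℂ}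
    (hx : Function.Injective x) (a b : Fin n) :
    (thetaGraph k (Set.range x)).Adj (x a) (x b) ↔ a ≠ b ∧
      ((∀ c, x c ∉ thetaBlock k (x a) (x b)) ∨ ∀ c, x c ∉ thetaBlock k (x b) (x a)) := by
  change (x a ≠ x b ∧ _) ↔ _
  rw [exists_thetaChooses_iff hk, exists_thetaChooses_iff hk, hx.ne_iff]
  refine and_congr_right fun hab => ?_
  simp [hx.ne_iff, hab, hab.symm]

/-- Inclusion-exclusion writes adjacency as [a chooses b] + [b chooses a] - [mutual]. Summing over
ordered pairs counts every edge twice, and the first two sums agree by symmetry. -/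
theorem thetaEdgeCount_range {k n : ℕ} (hk : 0 < k) {x : Fin n → ℂ}
    (hx : Function.Injective x) :
    (thetaEdgeCount k (Set.range x) : ℝ) = ∑ a, ∑ b, if a = b then 0 else
      ({y : Fin n → ℂ | ∀ c, y c ∉ thetaBlock k (y a) (y b)}.indicator 1 x
        - 1 / 2 * {y : Fin n → ℂ | ∀ c, y c ∉ mutualBlock k (y a) (y b)}.indicator 1 x : ℝ) := by
  classical
  let G := (thetaGraph k (Set.range x)).comap x
  have hG : ∀ a b, G.Adj a b ↔ a ≠ b ∧
      ((∀ c, x c ∉ thetaBlock k (x a) (x b)) ∨ ∀ c, x c ∉ thetaBlock k (x b) (x a)) :=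
    thetaGraph_range_adj_iff hk hx
  have hedge : (thetaGraph k (Set.range x)).edgeSet = Sym2.map x '' G.edgeSet := by
    ext e
    induction e using Sym2.ind with
    | _ u w =>
      constructor
      · intro h
        have hmem : u ∈ Set.range x ∧ w ∈ Set.range x := by
          rcases h.2 with ⟨i, hi⟩ | ⟨i, hi⟩
          · exact ⟨hi.1, hi.2.1⟩
          · exact ⟨hi.2.1, hi.1⟩
        obtain ⟨⟨a, rfl⟩, b, rfl⟩ := hmem
        exact ⟨s(a, b), h, rfl⟩
      · rintro ⟨e', he', heq⟩
        induction e' using Sym2.ind with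
        | _ a b =>
          rw [← heq]
          exact he'
  have hcard : thetaEdgeCount k (Set.range x) = G.edgeFinset.card := by
    rw [thetaEdgeCount, hedge, Set.ncard_image_of_injective _ (Sym2.map.injective hx),
      ← SimpleGraph.coe_edgeFinset, Set.ncard_coe_finset]
  have hdeg : (2 : ℝ) * G.edgeFinset.card = ∑ a, ∑ b, if G.Adj a b then (1 : ℝ) else 0 := by
    have := G.sum_degrees_eq_twice_card_edges
    have h2 : ((∑ a, G.degree a : ℕ) : ℝ) = 2 * G.edgeFinset.card := by exact_mod_cast this
    rw [← h2, Nat.cast_sum]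
    refine Finset.sum_congr rfl fun a _ => ?_
    rw [← SimpleGraph.card_neighborFinset_eq_degree, SimpleGraph.neighborFinset_eq_filter,
      Finset.card_filter, Nat.cast_sum]
    refine Finset.sum_congr rfl fun b _ => ?_
    split_ifs <;> simp
  let t : Fin n → Fin n → ℝ := fun a b => if a = b then 0 else
    {y : Fin n → ℂ | ∀ c, y c ∉ thetaBlock k (y a) (y b)}.indicator 1 x
  let m : Fin n → Fin n → ℝ := fun a b => if a = b then 0 else
    {y : Fin n → ℂ | ∀ c, y c ∉ mutualBlock k (y a) (y b)}.indicator 1 x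
  have hadj : ∀ a b, (if G.Adj a b then (1 : ℝ) else 0) = t a b + t b a - m a b := by
    intro a b
    rw [if_congr (hG a b) rfl rfl]
    rcases eq_or_ne a b with rfl | hab
    · simp [t, m]
    · simp only [t, m, hab, hab.symm, if_false, Set.indicator_apply, Set.mem_ofPred_eq, ne_eq,
        not_false_eq_true, true_and, Pi.one_apply]
      have hm : (∀ c, x c ∉ mutualBlock k (x a) (x b)) ↔
          (∀ c, x c ∉ thetaBlock k (x a) (x b)) ∧ ∀ c, x c ∉ thetaBlock k (x b) (x a) := by
        rw [← forall_and]
        exact forall_congr' fun c => not_or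
      rw [if_congr hm rfl rfl]
      by_cases h1 : ∀ c, x c ∉ thetaBlock k (x a) (x b) <;>
        by_cases h2 : ∀ c, x c ∉ thetaBlock k (x b) (x a) <;> simp [h1, h2]
  have hcomm : ∑ a, ∑ b, t b a = ∑ a, ∑ b, t a b := Finset.sum_comm
  have hrhs : ∀ a b, (if a = b then 0 else
      ({y : Fin n → ℂ | ∀ c, y c ∉ thetaBlock k (y a) (y b)}.indicator 1 x
        - 1 / 2 * {y : Fin n → ℂ | ∀ c, y c ∉ mutualBlock k (y a) (y b)}.indicator 1 x : ℝ))
      = t a b - 1 / 2 * m a b := by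
    intro a b
    by_cases hab : a = b <;> simp [t, m, hab]
  simp_rw [hadj, Finset.sum_sub_distrib, Finset.sum_add_distrib, hcomm] at hdeg
  simp_rw [hrhs, Finset.sum_sub_distrib, ← Finset.mul_sum]
  rw [hcard]
  linarith

theorem infinitePi_real_forall_notMem_block {k n : ℕ} {B : ℂ → ℂ → Set ℂ} (hB : IsBlocking k B)
    {a b : Fin n} (hab : a ≠ b) :
    (Measure.infinitePi fun _ : Fin n => uniformSquare).real
        {x | ∀ c, x c ∉ B (x a) (x b)}
      = ∫ u, ∫ w, avoidProb n B u w ∂uniformSquare ∂uniformSquare := by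
  have hpow : ∀ u w, uniformSquare (B u w)ᶜ ^ (n - 2) = ENNReal.ofReal (avoidProb n B u w) := by
    intro u w
    have hm := hB.measurableSet_apply u w
    have h1 : uniformSquare.real (B u w)ᶜ = 1 - volume.real (B u w ∩ unitSquare) := by
      rw [probReal_compl_eq_one_sub hm, measureReal_def, uniformSquare_eq,
        Measure.restrict_apply hm, measureReal_def]
    rw [avoidProb, ← h1, ENNReal.ofReal_pow measureReal_nonneg, ofReal_measureReal]
  have hmeas : Measurable fun u => ∫ w, avoidProb n B u w ∂uniformSquare :=
    ((measurable_avoidProb hB n).stronglyMeasurable.integral_prod_right'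
      (ν := uniformSquare)).measurable
  have hin : ∀ u, ∫⁻ w, ENNReal.ofReal (avoidProb n B u w) ∂uniformSquare
      = ENNReal.ofReal (∫ w, avoidProb n B u w ∂uniformSquare) := fun u =>
    (ofReal_integral_eq_lintegral_ofReal (integrable_avoidProb hB n u)
      (ae_of_all _ fun w => avoidProb_nonneg _ _ _ _)).symm
  rw [measureReal_def, infinitePi_forall_notMem_block uniformSquare hB.measurableSet
    hB.left_notMem hB.right_notMem hab, Fintype.card_fin]
  simp_rw [hpow, hin]
  exact (integral_eq_lintegral_of_nonneg_ae
    (ae_of_all _ fun u => integral_nonneg fun w => avoidProb_nonneg _ _ _ _)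
    hmeas.aestronglyMeasurable).symm

theorem ae_injective_uniform (n : ℕ) :
    ∀ᵐ x ∂(Measure.infinitePi fun _ : Fin n => uniformSquare), Function.Injective x := by
  have h : ∀ a b : Fin n, a ≠ b →
      ∀ᵐ x ∂(Measure.infinitePi fun _ : Fin n => uniformSquare), x a ≠ x b := by
    intro a b hab
    rw [ae_iff]
    simp only [ne_eq, not_not]
    refine infinitePi_eq_zero_of_update _ a
      (measurableSet_eq_fun (measurable_pi_apply a) (measurable_pi_apply b)) fun ω => ?_
    have : {x | Function.update ω a x ∈ {y : Fin n → ℂ | y a = y b}} = {ω b} := by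
      ext x
      simp [hab.symm]
    rw [this, uniformSquare_eq]
    exact Measure.absolutelyContinuous_of_le Measure.restrict_le_self (by simp)
  have h' := ae_all_iff.2 fun a => ae_all_iff.2 fun b => ae_all_iff.2 (h a b)
  filter_upwards [h'] with x hx a b hab
  by_contra hne
  exact hx a b hne hab

/-- The number of edges of the `θ_k`-graph of distinct points, as a sum of indicators. -/
noncomputable def edgeSum (k n : ℕ) (x : Fin n → ℂ) : ℝ :=
  ∑ a, ∑ b, if a = b then 0 else
    ({y : Fin n → ℂ | ∀ c, y c ∉ thetaBlock k (y a) (y b)}.indicator 1 x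
      - 1 / 2 * {y : Fin n → ℂ | ∀ c, y c ∉ mutualBlock k (y a) (y b)}.indicator 1 x)

theorem integrable_edgeSum_summand {k n : ℕ} (hk : 3 ≤ k) (a b : Fin n) :
    Integrable (fun x => if a = b then 0 else
      ({y : Fin n → ℂ | ∀ c, y c ∉ thetaBlock k (y a) (y b)}.indicator 1 x
        - 1 / 2 * {y : Fin n → ℂ | ∀ c, y c ∉ mutualBlock k (y a) (y b)}.indicator 1 x : ℝ))
      (Measure.infinitePi fun _ : Fin n => uniformSquare) := by
  split_ifs
  · exact integrable_zero _ _ _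
  · have hT := measurableSet_forall_notMem_block (isBlocking_thetaBlock hk).measurableSet a b
    have hA := measurableSet_forall_notMem_block (isBlocking_mutualBlock hk).measurableSet a b
    exact ((integrable_const (1 : ℝ)).indicator hT).sub
      (((integrable_const (1 : ℝ)).indicator hA).const_mul _)

theorem integrable_edgeSum {k : ℕ} (hk : 3 ≤ k) (n : ℕ) :
    Integrable (edgeSum k n) (Measure.infinitePi fun _ : Fin n => uniformSquare) :=
  integrable_finsetSum _ fun a _ => integrable_finsetSum _ fun b _ =>
    integrable_edgeSum_summand hk a b

theorem integral_edgeSum {k n : ℕ} (hk : 3 ≤ k) (hn : 2 ≤ n) :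
    ∫ x, edgeSum k n x ∂(Measure.infinitePi fun _ : Fin n => uniformSquare)
      = n * (∫ u, freeCount n (thetaBlock k) u ∂uniformSquare
        - 1 / 2 * ∫ u, freeCount n (mutualBlock k) u ∂uniformSquare) := by
  have hT := isBlocking_thetaBlock hk
  have hA := isBlocking_mutualBlock hk
  have hsum : ∀ a b : Fin n, ∫ x, (if a = b then 0 else
      ({y : Fin n → ℂ | ∀ c, y c ∉ thetaBlock k (y a) (y b)}.indicator 1 x
        - 1 / 2 * {y : Fin n → ℂ | ∀ c, y c ∉ mutualBlock k (y a) (y b)}.indicator 1 x : ℝ))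
        ∂(Measure.infinitePi fun _ : Fin n => uniformSquare)
      = if a = b then 0 else
        (∫ u, ∫ w, avoidProb n (thetaBlock k) u w ∂uniformSquare ∂uniformSquare
        - 1 / 2 * ∫ u, ∫ w, avoidProb n (mutualBlock k) u w ∂uniformSquare ∂uniformSquare) := by
    intro a b
    split_ifs with hab
    · simp
    · have hTm := measurableSet_forall_notMem_block hT.measurableSet a b
      have hAm := measurableSet_forall_notMem_block hA.measurableSet a b
      have hTi : Integrable ({y : Fin n → ℂ | ∀ c, y c ∉ thetaBlock k (y a) (y b)}.indicator
          (1 : (Fin n → ℂ) → ℝ)) (Measure.infinitePi fun _ : Fin n => uniformSquare) :=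
        (integrable_const (1 : ℝ)).indicator hTm
      have hAi : Integrable ({y : Fin n → ℂ | ∀ c, y c ∉ mutualBlock k (y a) (y b)}.indicator
          (1 : (Fin n → ℂ) → ℝ)) (Measure.infinitePi fun _ : Fin n => uniformSquare) :=
        (integrable_const (1 : ℝ)).indicator hAm
      rw [integral_sub hTi (hAi.const_mul _), integral_const_mul,
        integral_indicator_one hTm, integral_indicator_one hAm,
        infinitePi_real_forall_notMem_block hT hab, infinitePi_real_forall_notMem_block hA hab]
  simp only [edgeSum, freeCount]
  rw [integral_finsetSum _ fun a _ => integrable_finsetSum _ fun b _ =>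
    integrable_edgeSum_summand hk a b]
  simp_rw [fun a => integral_finsetSum (Finset.univ : Finset (Fin n)) fun b _ =>
    integrable_edgeSum_summand hk a b, hsum, integral_const_mul]
  simp only [Finset.sum_ite, Finset.sum_const_zero, zero_add, Finset.sum_const, nsmul_eq_mul]
  have hc : ∀ a : Fin n, ((Finset.univ.filter fun b => ¬a = b).card : ℝ) = n - 1 := by
    intro a
    rw [Finset.filter_not, Finset.filter_eq, if_pos (Finset.mem_univ a),
      Finset.card_sdiff_of_subset (by simp), Finset.card_univ, Fintype.card_fin,
      Finset.card_singleton, Nat.cast_sub (by omega), Nat.cast_one]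
  simp_rw [hc]
  rw [Finset.sum_const, Finset.card_univ, Fintype.card_fin, nsmul_eq_mul]
  ring

/-! ### The main estimate -/

theorem mainTheorem3 :
    ∃ C : ℝ, ∀ (k n : ℕ), 3 ≤ k → 2 ≤ n →
      ∀ {Ω : Type*} [MeasurableSpace Ω] (P : Measure Ω) [IsProbabilityMeasure P]
        (X : Fin n → Ω → ℂ), iIndepFun X P → (∀ a, P.map (X a) = uniformSquare) →
        Integrable (fun ω => (thetaEdgeCount k (Set.range fun a => X a ω) : ℝ)) P ∧
        |(∫ ω, (thetaEdgeCount k (Set.range fun a => X a ω) : ℝ) ∂P) - n * avgDegree k / 2|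
          ≤ C * (k * Real.sqrt (n * k * Real.log n)) := by
  refine ⟨300, fun k n hk hn Ω _ P _ X hindep hlaw => ?_⟩
  have hX : ∀ a, AEMeasurable (X a) P := fun a => by
    -- Measurability of `X a` comes from its law: `Measure.map` is zero for functions that are not
    -- a.e. measurable, while the uniform law is not zero.
    have : NeZero (P.map (X a)) := by
      rw [hlaw a]
      infer_instance
    exact aemeasurable_of_map_neZero this
  have hXm : AEMeasurable (fun ω a => X a ω) P := aemeasurable_pi_lambda _ hX
  have hmap : P.map (fun ω a => X a ω) = Measure.infinitePi fun _ : Fin n => uniformSquare := by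
    rw [iIndepFun.map_fun_eq_infinitePi_map₀' hX hindep]
    simp_rw [hlaw]
  have hae : (fun ω => (thetaEdgeCount k (Set.range fun a => X a ω) : ℝ))
      =ᵐ[P] fun ω => edgeSum k n fun a => X a ω := by
    have h := ae_injective_uniform n
    rw [← hmap] at h
    filter_upwards [ae_of_ae_map hXm h] with ω hω
    exact thetaEdgeCount_range (by omega) hω
  have hint := integrable_edgeSum hk n
  rw [← hmap] at hint
  refine ⟨(hint.comp_aemeasurable hXm).congr hae.symm, ?_⟩
  have hE : ∫ ω, (thetaEdgeCount k (Set.range fun a => X a ω) : ℝ) ∂P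
      = n * (∫ u, freeCount n (thetaBlock k) u ∂uniformSquare
        - 1 / 2 * ∫ u, freeCount n (mutualBlock k) u ∂uniformSquare) := by
    rw [integral_congr_ae hae, ← integral_edgeSum hk hn, ← hmap,
      integral_map hXm hint.aestronglyMeasurable]
  have h1 := abs_integral_freeCount_sub_le hk hn (isBlocking_thetaBlock hk)
  have h2 := abs_integral_freeCount_sub_le hk hn (isBlocking_mutualBlock hk)
  rw [freeIntegral_thetaBlock hk] at h1
  have hn0 : (0 : ℝ) < n := by positivity
  have hk0 : (0 : ℝ) < k := by positivity
  have hlog := Real.log_natCast_nonneg n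
  -- The exact factor is √2, rounded up to 2.
  have hcut : n * cutoff k n ≤ 2 * Real.sqrt (n * k * Real.log n) := by
    refine abs_le_of_sq_le_sq' ?_ (by positivity) |>.2
    rw [mul_pow, mul_pow, cutoff_sq, Real.sq_sqrt (by positivity)]
    have : (n : ℝ) ^ 2 * (2 * k * Real.log n / n) = 2 * (n * k * Real.log n) := by
      field_simp
    rw [this]
    have : 0 ≤ n * k * Real.log n := by positivity
    linarith
  set a := ∫ u, freeCount n (thetaBlock k) u ∂uniformSquare
  set b := ∫ u, freeCount n (mutualBlock k) u ∂uniformSquare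
  rw [hE, avgDegree_eq hk]
  have e : n * (a - 1 / 2 * b) - n * (2 * k - freeIntegral (mutualBlock k)) / 2
      = n * ((a - k) - 1 / 2 * (b - freeIntegral (mutualBlock k))) := by ring
  rw [e, abs_mul, abs_of_pos hn0]
  have h3 : |(a - k) - 1 / 2 * (b - freeIntegral (mutualBlock k))| ≤ 150 * k * cutoff k n := by
    obtain ⟨h1l, h1r⟩ := abs_le.1 h1
    obtain ⟨h2l, h2r⟩ := abs_le.1 h2
    rw [abs_le]
    constructor <;> linarith
  calc n * |(a - k) - 1 / 2 * (b - freeIntegral (mutualBlock k))|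
      ≤ n * (150 * k * cutoff k n) := by gcongr
    _ = 150 * k * (n * cutoff k n) := by ring
    _ ≤ 150 * k * (2 * Real.sqrt (n * k * Real.log n)) := by gcongr
    _ = 300 * (k * Real.sqrt (n * k * Real.log n)) := by ring
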